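/- Let $X$ be a finite set of features. An entity over $X$ is a function $e:X\to\{0,1\}$, and a Boolean classifier over $X$ is a function $M:\{0,1\}^X\to\{0,1\}$. For $S\subseteq X$ let $\phi(M,e,S)=\mathbb E[M(e')\mid e'(y)=e(y)\text{ for all }y\in S]$, where $e'$ is uniformly distributed over $\{0,1\}^X$. The SHAP-score of a feature $x\in X$ on $e$ is $$\mathsf{SHAP}(M,e,x)=\sum_{S\subseteq X\setminus\{x\}}\frac{|S|!\,(|X|-|S|-1)!}{|X|!}\bigl(\phi(M,e,S\cup\{x\})-\phi(M,e,S)\bigr).$$ A binary decision diagram (BDD) over $X$ is a rooted directed acyclic graph in which each internal node is labelled with a variable from $X$ and has exactly two outgoing edges, one labelled $0$ and one labelled $1$, and each leaf is labelled $0$ or $1$. Its value on $e$ is the label of the leaf that is reached from the root by leaving each internal node labelled $y$ through its edge labelled $e(y)$. It is free (an FBDD) if no two nodes on a path from the root to a leaf have the same label, ordered (an OBDD) if there is a linear order of $X$ such that the labels strictly increase along every path from the root to a leaf, and a binary decision tree if it is an FBDD whose underlying graph is a tree. A Boolean circuit over $X$ is a directed acyclic graph in which every node without incoming edges is a variable gate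 (labelled with a variable from $X$) or a constant gate (labelled $0$ or $1$), every other node is an $\land$-, $\lor$- or $\lnot$-gate (with exactly one input in the case of $\lnot$), and exactly one node, the output gate, has no outgoing edge. It is a d-DNNF if it is deterministic (no entity is accepted at two distinct inputs of an $\lor$-gate), decomposable (no variable occurs below two distinct inputs of an $\land$-gate) and in negation normal form (the input of every $\lnot$-gate is a variable gate). For each of the following four classes of representations of Boolean classifiers: binary decision trees, OBDDs, FBDDs and d-DNNFs, this problem can be solved in polynomial time: given as input a representation $T$ in the class, over a set of features $X$, an entity $e:X\to\{0,1\}$ and a feature $x\in X$, compute the rational number $\mathsf{SHAP}(T,e,x)$, the SHAP-score of $x$ on $e$ with respect to the classifier that $T$ represents. -/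

import Mathlib

namespace ShapScore

/-! ### Entities, classifiers and the SHAP-score under the uniform distribution -/

section Score

variable {X : Type*} [Fintype X] [DecidableEq X]

/-- The uniform probability of an event `A`, a set of entities over `X`. -/
def prob (A : Finset (X → Bool)) : ℚ := (A.card : ℚ) / 2 ^ Fintype.card X

/-- The expectation of the Boolean (`0`/`1`-valued) classifier `M` under the uniform distribution,
conditioned on the event `A`. -/
def condExpectation (M : (X → Bool) → Bool) (A : Finset (X → Bool)) : ℚ :=
  (∑ e' ∈ A, (if M e' = true then (1 : ℚ) else 0) * prob {e'}) / prob A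

/-- The set of entities that are consistent with `e` on `S`. -/
def cw (e : X → Bool) (S : Finset X) : Finset (X → Bool) :=
  Finset.univ.filter fun e' => ∀ y ∈ S, e' y = e y

/-- The expected value of `M` over `X \ S` with respect to `e`. -/
def phi (M : (X → Bool) → Bool) (e : X → Bool) (S : Finset X) : ℚ :=
  condExpectation M (cw e S)

/-- The SHAP-score of the feature `x` on the entity `e` with respect to the classifier `M`. -/
def shap (M : (X → Bool) → Bool) (e : X → Bool) (x : X) : ℚ :=
  ∑ S ∈ (Finset.univ.erase x).powerset,
    ((S.card.factorial : ℚ) * ((Fintype.card X - S.card - 1).factorial : ℚ)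
        / ((Fintype.card X).factorial : ℚ))
      * (phi M e (insert x S) - phi M e S)

end Score

/-- A finite directed graph without directed cycles has a well-founded edge relation. -/
theorem wellFounded_of_acyclic {V : Type*} [Finite V] {r : V → V → Prop}
    (h : ∀ v, ¬ Relation.TransGen r v v) : WellFounded r := by
  have : Std.Irrefl (Relation.TransGen r) := ⟨h⟩
  have hw : WellFounded (Relation.TransGen r) := Finite.wellFounded_of_trans_of_irrefl _
  exact Subrelation.wf (fun hab => Relation.TransGen.single hab) hw

/-! ### Binary decision diagrams -/

/-- A node of a binary decision diagram over the features `Fin n` with node set `Fin m`: a leaf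
with its label, or an internal node with its variable and the targets of its outgoing edges
labelled `0` (`lo`) and `1` (`hi`). -/
inductive BDDNode (n m : ℕ) : Type
  | leaf (b : Bool) : BDDNode n m
  | branch (x : Fin n) (lo hi : Fin m) : BDDNode n m

namespace BDDNode

variable {n m : ℕ}

/-- `u.Target b v`: the node `u` is internal, and its outgoing edge labelled `b` leads to `v`. -/
def Target (u : BDDNode n m) (b : Bool) (v : Fin m) : Prop :=
  ∃ x lo hi, u = branch x lo hi ∧ v = if b = true then hi else lo

/-- `u.HasLabel x`: the node `u` is internal and labelled with the variable `x`. -/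
def HasLabel (u : BDDNode n m) (x : Fin n) : Prop := ∃ lo hi, u = branch x lo hi

end BDDNode

/-- A binary decision diagram over the features `Fin n`: a rooted directed acyclic graph. -/
structure BDD (n : ℕ) where
  /-- the number of nodes -/
  size : ℕ
  node : Fin size → BDDNode n size
  root : Fin size
  acyclic : ∀ u, ¬ Relation.TransGen (fun v w => ∃ b, (node v).Target b w) u u
  rooted : ∀ u, Relation.ReflTransGen (fun v w => ∃ b, (node v).Target b w) root u

namespace BDD

variable {n : ℕ}

/-- There is an edge from `u` to `v`. -/
def Edge (D : BDD n) (u v : Fin D.size) : Prop := ∃ b, (D.node u).Target b v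

theorem wf (D : BDD n) : WellFounded fun v u => D.Edge u v := by
  apply wellFounded_of_acyclic
  intro u h
  exact D.acyclic u (Relation.transGen_swap.mp h)

/-- The label of the leaf at the end of the path that starts at the given node and leaves every
internal node labelled `x` through its edge labelled `e x`. -/
def value (D : BDD n) (e : Fin n → Bool) : Fin D.size → Bool :=
  D.wf.fix fun u ih =>
    match h : D.node u with
    | .leaf b => b
    | .branch x lo hi =>
      ih (if e x = true then hi else lo) ⟨e x, x, lo, hi, h, rfl⟩

theorem value_leaf (D : BDD n) (e : Fin n → Bool) (u : Fin D.size) (b : Bool)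
    (h : D.node u = .leaf b) : D.value e u = b := by
  unfold value
  rw [WellFounded.fix_eq]
  split <;> simp_all

theorem value_branch (D : BDD n) (e : Fin n → Bool) (u : Fin D.size) (x : Fin n)
    (lo hi : Fin D.size) (h : D.node u = .branch x lo hi) :
    D.value e u = D.value e (if e x = true then hi else lo) := by
  unfold value
  rw [WellFounded.fix_eq]
  split
  · simp_all
  · rename_i h₁
    rw [h] at h₁
    cases h₁
    rfl

/-- The Boolean classifier represented by a binary decision diagram. -/
def classifier (D : BDD n) (e : Fin n → Bool) : Bool := D.value e D.root

/-- `D` is free (an FBDD): no two nodes on a directed path have the same label. (All nodes are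
reachable from the root and every maximal path ends in a leaf, so these are the paths from the
root to a leaf and their segments.) -/
def IsFree (D : BDD n) : Prop :=
  ∀ u v x, Relation.TransGen D.Edge u v → (D.node u).HasLabel x → ¬ (D.node v).HasLabel x

/-- `D` is ordered (an OBDD): for some linear order of the features, which a permutation lists,
the labels strictly increase along every edge between internal nodes, hence along every path. -/
def IsOrdered (D : BDD n) : Prop :=
  ∃ rank : Equiv.Perm (Fin n), ∀ u v x y,
    D.Edge u v → (D.node u).HasLabel x → (D.node v).HasLabel y → rank x < rank y

/-- `D` is a binary decision tree: it is free and no node has two incoming edges. (All nodes are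
reachable from the root, and the root has no incoming edge since `D` is acyclic, so this says that
the underlying graph is a tree.) -/
def IsDecisionTree (D : BDD n) : Prop :=
  D.IsFree ∧
    ∀ u v w b c, (D.node u).Target b w → (D.node v).Target c w → u = v ∧ b = c

end BDD

/-! ### Boolean circuits -/

/-- A gate of a Boolean circuit over the features `Fin n` with set of gates `Fin m`; logic gates
come with the set of their input gates. -/
inductive Gate (n m : ℕ) : Type
  | const (b : Bool) : Gate n m
  | var (x : Fin n) : Gate n m
  | not (g : Fin m) : Gate n m
  | and (s : Finset (Fin m)) : Gate n m
  | or (s : Finset (Fin m)) : Gate n m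

/-- The set of input gates of a gate. -/
def Gate.inputs {n m : ℕ} : Gate n m → Finset (Fin m)
  | .const _ => ∅
  | .var _ => ∅
  | .not g => {g}
  | .and s => s
  | .or s => s

/-- A Boolean circuit over the features `Fin n`: a directed acyclic graph of gates in which all
`∧`- and `∨`-gates have at least one input and exactly one gate, the output gate, has no outgoing
edge. -/
structure Circuit (n : ℕ) where
  /-- the number of gates -/
  size : ℕ
  gate : Fin size → Gate n size
  output : Fin size
  acyclic : ∀ g, ¬ Relation.TransGen (fun g₁ g₂ => g₁ ∈ (gate g₂).inputs) g g
  and_nonempty : ∀ g s, gate g = .and s → s.Nonempty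
  or_nonempty : ∀ g s, gate g = .or s → s.Nonempty
  output_iff : ∀ g, (∀ g₁, g ∉ (gate g₁).inputs) ↔ g = output

namespace Circuit

variable {n : ℕ}

/-- There is an edge from `g₁` to `g₂`: the gate `g₁` is an input of `g₂`. -/
def Edge (C : Circuit n) (g₁ g₂ : Fin C.size) : Prop := g₁ ∈ (C.gate g₂).inputs

theorem wf (C : Circuit n) : WellFounded C.Edge := wellFounded_of_acyclic C.acyclic

/-- The value of a gate of the circuit when it is evaluated over the entity `e`. -/
def value (C : Circuit n) (e : Fin n → Bool) : Fin C.size → Bool :=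
  C.wf.fix fun g ih =>
    match h : C.gate g with
    | .const b => b
    | .var x => e x
    | .not g₁ => !(ih g₁ (by simp [Edge, h, Gate.inputs]))
    | .and s => decide (∀ g₁, ∀ hg : g₁ ∈ s, ih g₁ (by simpa [Edge, h, Gate.inputs] using hg) = true)
    | .or s => decide (∃ g₁, ∃ hg : g₁ ∈ s, ih g₁ (by simpa [Edge, h, Gate.inputs] using hg) = true)

theorem value_const (C : Circuit n) (e : Fin n → Bool) (g : Fin C.size) (b : Bool)
    (h : C.gate g = .const b) : C.value e g = b := by
  unfold value
  rw [WellFounded.fix_eq]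
  split <;> simp_all

theorem value_var (C : Circuit n) (e : Fin n → Bool) (g : Fin C.size) (x : Fin n)
    (h : C.gate g = .var x) : C.value e g = e x := by
  unfold value
  rw [WellFounded.fix_eq]
  split <;> simp_all

theorem value_not (C : Circuit n) (e : Fin n → Bool) (g g₁ : Fin C.size)
    (h : C.gate g = .not g₁) : C.value e g = !(C.value e g₁) := by
  unfold value
  rw [WellFounded.fix_eq]
  split <;> rename_i h₁ <;> rw [h] at h₁ <;> cases h₁
  rfl

theorem value_and (C : Circuit n) (e : Fin n → Bool) (g : Fin C.size) (s : Finset (Fin C.size))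
    (h : C.gate g = .and s) : C.value e g = decide (∀ g₁ ∈ s, C.value e g₁ = true) := by
  unfold value
  rw [WellFounded.fix_eq]
  split <;> simp_all

theorem value_or (C : Circuit n) (e : Fin n → Bool) (g : Fin C.size) (s : Finset (Fin C.size))
    (h : C.gate g = .or s) : C.value e g = decide (∃ g₁ ∈ s, C.value e g₁ = true) := by
  unfold value
  rw [WellFounded.fix_eq]
  split <;> simp_all

/-- The Boolean classifier represented by a circuit. -/
def classifier (C : Circuit n) (e : Fin n → Bool) : Bool := C.value e C.output

/-- The set of variables that label a variable gate from which there is a path to `g`. -/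
def vars (C : Circuit n) (g : Fin C.size) : Set (Fin n) :=
  {x | ∃ g₁, Relation.ReflTransGen C.Edge g₁ g ∧ C.gate g₁ = .var x}

/-- No entity is accepted at two distinct inputs of an `∨`-gate. -/
def IsDeterministic (C : Circuit n) : Prop :=
  ∀ g s, C.gate g = .or s → ∀ g₁ ∈ s, ∀ g₂ ∈ s, g₁ ≠ g₂ →
    ¬ ∃ e, C.value e g₁ = true ∧ C.value e g₂ = true

/-- Distinct inputs of an `∧`-gate depend on disjoint sets of variables. -/
def IsDecomposable (C : Circuit n) : Prop :=
  ∀ g s, C.gate g = .and s → ∀ g₁ ∈ s, ∀ g₂ ∈ s, g₁ ≠ g₂ → C.vars g₁ ∩ C.vars g₂ = ∅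

/-- Negation normal form: only variables are negated. -/
def IsNNF (C : Circuit n) : Prop :=
  ∀ g g₁, C.gate g = .not g₁ → ∃ x, C.gate g₁ = .var x

/-- Deterministic and decomposable negation normal forms. -/
def IsdDNNF (C : Circuit n) : Prop := C.IsDeterministic ∧ C.IsDecomposable ∧ C.IsNNF

end Circuit

/-! ### Random access machines with logarithmic cost -/

/-- A memory state: the contents of the registers, and of the cells of the arrays. -/
structure State where
  reg : ℕ → ℕ
  arr : ℕ → ℕ → ℕ

/-- Write `v` to register `r`. -/
def State.setReg (s : State) (r v : ℕ) : State :=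
  { s with reg := Function.update s.reg r v }

/-- Write `v` to cell `i` of array `a`. -/
def State.setArr (s : State) (a i v : ℕ) : State :=
  { s with arr := Function.update s.arr a (Function.update (s.arr a) i v) }

/-- The arithmetical operations: sum, truncated difference, product and integer quotient. -/
inductive Op : Type
  | add : Op
  | sub : Op
  | mul : Op
  | div : Op

def Op.apply : Op → ℕ → ℕ → ℕ
  | .add, x, y => x + y
  | .sub, x, y => x - y
  | .mul, x, y => x * y
  | .div, x, y => x / y

/-- Programs of a random access machine with structured control. Registers and arrays are named by
constants of the program; cells of arrays are addressed indirectly, through registers. -/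
inductive Program : Type
  /-- `R[r] := v` for a constant `v` -/
  | const (r v : ℕ) : Program
  /-- `R[r] := R[i] op R[j]` -/
  | arith (op : Op) (r i j : ℕ) : Program
  /-- `R[r] := A[a][R[i]]` -/
  | load (r a i : ℕ) : Program
  /-- `A[a][R[i]] := R[j]` -/
  | store (a i j : ℕ) : Program
  /-- run the first program, then the second one -/
  | seq (p q : Program) : Program
  /-- if `R[r]` is not zero, run the first program, otherwise the second one -/
  | cond (r : ℕ) (p q : Program) : Program
  /-- while `R[r]` is not zero, run the program -/
  | loop (r : ℕ) (p : Program) : Program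

/-- `Exec p s t s'`: started in the state `s`, the program `p` halts in the state `s'` after time
`t`. By the logarithmic cost criterion every instruction and every test takes one unit of time plus
the lengths, in binary (`Nat.size`), of the numbers and addresses that it handles. Running times are
therefore polynomially related to those of Turing machines. -/
inductive Exec : Program → State → ℕ → State → Prop
  | const (s : State) (r v : ℕ) : Exec (.const r v) s (1 + v.size) (s.setReg r v)
  | arith (s : State) (op : Op) (r i j : ℕ) :
      Exec (.arith op r i j) s
        (1 + (s.reg i).size + (s.reg j).size + (op.apply (s.reg i) (s.reg j)).size)
        (s.setReg r (op.apply (s.reg i) (s.reg j)))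
  | load (s : State) (r a i : ℕ) :
      Exec (.load r a i) s (1 + (s.reg i).size + (s.arr a (s.reg i)).size)
        (s.setReg r (s.arr a (s.reg i)))
  | store (s : State) (a i j : ℕ) :
      Exec (.store a i j) s (1 + (s.reg i).size + (s.reg j).size)
        (s.setArr a (s.reg i) (s.reg j))
  | seq (p q : Program) (s s₁ s₂ : State) (t₁ t₂ : ℕ) :
      Exec p s t₁ s₁ → Exec q s₁ t₂ s₂ → Exec (.seq p q) s (t₁ + t₂) s₂
  | cond_true (r : ℕ) (p q : Program) (s s₁ : State) (t : ℕ) :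
      s.reg r ≠ 0 → Exec p s t s₁ → Exec (.cond r p q) s (1 + (s.reg r).size + t) s₁
  | cond_false (r : ℕ) (p q : Program) (s s₁ : State) (t : ℕ) :
      s.reg r = 0 → Exec q s t s₁ → Exec (.cond r p q) s (1 + (s.reg r).size + t) s₁
  | loop_stop (r : ℕ) (p : Program) (s : State) :
      s.reg r = 0 → Exec (.loop r p) s (1 + (s.reg r).size) s
  | loop_step (r : ℕ) (p : Program) (s s₁ s₂ : State) (t₁ t₂ : ℕ) :
      s.reg r ≠ 0 → Exec p s t₁ s₁ → Exec (.loop r p) s₁ t₂ s₂ →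
      Exec (.loop r p) s (1 + (s.reg r).size + t₁ + t₂) s₂

/-- A program has at most one halting run from a given state. -/
theorem Exec.deterministic {p : Program} {s : State} {t₁ t₂ : ℕ} {s₁ s₂ : State}
    (h₁ : Exec p s t₁ s₁) (h₂ : Exec p s t₂ s₂) : t₁ = t₂ ∧ s₁ = s₂ := by
  induction h₁ generalizing t₂ s₂ with
  | const => cases h₂; exact ⟨rfl, rfl⟩
  | arith => cases h₂; exact ⟨rfl, rfl⟩
  | load => cases h₂; exact ⟨rfl, rfl⟩
  | store => cases h₂; exact ⟨rfl, rfl⟩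
  | seq p q s _ _ _ _ _ _ ih₁ ih₂ =>
    cases h₂ with
    | seq _ _ _ _ _ _ _ k₁ k₂ =>
      obtain ⟨rfl, rfl⟩ := ih₁ k₁
      obtain ⟨rfl, rfl⟩ := ih₂ k₂
      exact ⟨rfl, rfl⟩
  | cond_true _ _ _ _ _ _ h _ ih =>
    cases h₂ with
    | cond_true _ _ _ _ _ _ _ k =>
      obtain ⟨rfl, rfl⟩ := ih k
      exact ⟨rfl, rfl⟩
    | cond_false _ _ _ _ _ _ k _ => exact absurd k h
  | cond_false _ _ _ _ _ _ h _ ih =>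
    cases h₂ with
    | cond_true _ _ _ _ _ _ k _ => exact absurd h k
    | cond_false _ _ _ _ _ _ _ k =>
      obtain ⟨rfl, rfl⟩ := ih k
      exact ⟨rfl, rfl⟩
  | loop_stop _ _ _ h =>
    cases h₂ with
    | loop_stop => exact ⟨rfl, rfl⟩
    | loop_step _ _ _ _ _ _ _ k _ _ => exact absurd h k
  | loop_step _ _ _ _ _ _ _ h _ _ ih₁ ih₂ =>
    cases h₂ with
    | loop_stop _ _ _ k => exact absurd k h
    | loop_step _ _ _ _ _ _ _ _ k₁ k₂ =>
      obtain ⟨rfl, rfl⟩ := ih₁ k₁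
      obtain ⟨rfl, rfl⟩ := ih₂ k₂
      exact ⟨rfl, rfl⟩

/-- The initial state on the input `w`: the input is in array `0`, its length in register `0`, and
everything else is `0`. -/
def initialState (w : List ℕ) : State where
  reg r := if r = 0 then w.length else 0
  arr a i := if a = 0 then w.getD i 0 else 0

/-- The length of an input: the number of its binary digits, with a separator for every number. -/
def inputLength (w : List ℕ) : ℕ := (w.map fun v => v.size + 1).sum

/-- In the state `s`, the registers `0`, `1`, `2` hold the sign, the numerator and the denominator
of a fraction with value `y`. -/
def State.HoldsRat (s : State) (y : ℚ) : Prop :=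
  s.reg 2 ≠ 0 ∧ y = (-1) ^ s.reg 0 * (s.reg 1 : ℚ) / (s.reg 2 : ℚ)

/-- The rational-valued function `f` can be computed in polynomial time on the instances that
satisfy `P` and are given through the encoding `enc`. -/
def PolyTimeComputable {I : Type} (P : I → Prop) (enc : I → List ℕ) (f : I → ℚ) : Prop :=
  ∃ (p : Program) (q : Polynomial ℕ), ∀ i, P i →
    ∃ (t : ℕ) (s : State), Exec p (initialState (enc i)) t s ∧
      t ≤ q.eval (inputLength (enc i)) ∧ s.HoldsRat (f i)

/-! ### The problem of computing the SHAP-score -/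

/-- The input of the problem: a set `Fin n` of features, a classifier over it given by a
representation of the kind `R n`, an entity and a feature. -/
structure Input (R : ℕ → Type) where
  n : ℕ
  repr : R n
  entity : Fin n → Bool
  feature : Fin n

def BDDNode.encode {n m : ℕ} : BDDNode n m → List ℕ
  | .leaf b => [0, b.toNat, 0, 0]
  | .branch x lo hi => [1, x, lo, hi]

/-- Number of nodes, root, and then the nodes one after the other. -/
def BDD.encode {n : ℕ} (D : BDD n) : List ℕ :=
  [D.size, (D.root : ℕ)] ++ (List.ofFn fun u => (D.node u).encode).flatten

/-- Kind and label of a gate. -/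
def Gate.encodeKind {n m : ℕ} : Gate n m → List ℕ
  | .const b => [0, b.toNat]
  | .var x => [1, x]
  | .not _ => [2, 0]
  | .and _ => [3, 0]
  | .or _ => [4, 0]

/-- Kind and label of a gate, followed by the characteristic vector of its set of inputs, that is,
its column in the adjacency matrix of the circuit. -/
def Gate.encode {n m : ℕ} (G : Gate n m) : List ℕ :=
  G.encodeKind ++ List.ofFn fun g : Fin m => if g ∈ G.inputs then 1 else 0

/-- Number of gates, output gate, and then the gates one after the other. -/
def Circuit.encode {n : ℕ} (C : Circuit n) : List ℕ :=
  [C.size, (C.output : ℕ)] ++ (List.ofFn fun g => (C.gate g).encode).flatten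

/-- Number of features, feature, entity (bit by bit), and then the representation. -/
def Input.encode {R : ℕ → Type} (encR : ∀ n, R n → List ℕ) (i : Input R) : List ℕ :=
  [i.n, (i.feature : ℕ)] ++ (List.ofFn fun y => (i.entity y).toNat) ++ encR i.n i.repr

/-- The SHAP-score under the uniform distribution can be computed in polynomial time for the binary
decision diagrams that satisfy `P`. -/
def ShapPolyTimeBDD (P : ∀ {n : ℕ}, BDD n → Prop) : Prop :=
  PolyTimeComputable (I := Input BDD) (fun i => P i.repr) (Input.encode fun _ D => D.encode)
    fun i => shap i.repr.classifier i.entity i.feature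

/-- The SHAP-score under the uniform distribution can be computed in polynomial time for the
Boolean circuits that satisfy `P`. -/
def ShapPolyTimeCircuit (P : ∀ {n : ℕ}, Circuit n → Prop) : Prop :=
  PolyTimeComputable (I := Input Circuit) (fun i => P i.repr) (Input.encode fun _ C => C.encode)
    fun i => shap i.repr.classifier i.entity i.feature

end ShapScore

namespace ShapScore

/-! ### A language of expressions and counting loops, compiled to random access machines -/

/-! Multiplied by `n! * 2 ^ n`, the score is a signed sum over the accepted entities `e'`. The
summand is a number `contribution n k` depending only on the number `k` of features other than `x`
on which `e'` agrees with `e`, and the sign says whether `e' x = e x` (`shap_eq`). It therefore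
suffices to count the accepted entities for each `k` and each sign (`shap_eq_counts`).

All `2 * n` counts come from one weighted model count. Let agreement with `e` on a feature `y ≠ x`
have weight `B = 2 ^ n`, agreement on `x` weight `B ^ n`, and disagreement weight `1`. Every count
is less than `B` (`acceptedCount_lt`), so the counts are the base `B` digits of the weighted count
of the classifier (`wmc_agreeWeight`, `digit_eq`).

Weighted counts are computed node by node, always over all `n` features; let `T` be the total
weight. Below a branch on `y` in a free diagram nothing depends on `y`, so the count is a weighted
mean of those of the two children (`wmc_branch`). In a circuit, determinism makes disjunction
additive (`wmc_or`) and decomposability makes conjunction multiplicative up to division by `T`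
(`wmc_and`). Since all counts refer to the same set of features, no smoothing is needed, and the
divisions are exact.

No topological order is computed: all `m` nodes are evaluated `m` times over, and then every value
is right by induction on the number of nodes on which it depends (`rounds_ok`). Premature values are
meaningless but never exceed `T`, so the numbers keep a length cubic in that of the input. The
algorithms are written with counting loops of at most linearly many passes, and compilation to the
machine preserves polynomial time (`Cmd.compile_reaches`). -/

/-- All numbers in the memory have at most `M` binary digits. -/
def State.Bdd (M : ℕ) (s : State) : Prop :=
  (∀ r, s.reg r < 2 ^ M) ∧ ∀ a i, s.arr a i < 2 ^ M

theorem State.Bdd.setReg {M : ℕ} {s : State} (h : s.Bdd M) (r : ℕ) {v : ℕ} (hv : v < 2 ^ M) :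
    (s.setReg r v).Bdd M := by
  refine ⟨fun r' => ?_, h.2⟩
  by_cases hr : r' = r
  · subst hr; simpa [State.setReg] using hv
  · simpa [State.setReg, hr] using h.1 r'

theorem State.Bdd.setArr {M : ℕ} {s : State} (h : s.Bdd M) (a i : ℕ) {v : ℕ} (hv : v < 2 ^ M) :
    (s.setArr a i v).Bdd M := by
  refine ⟨h.1, fun a' i' => ?_⟩
  by_cases ha : a' = a
  · subst ha
    by_cases hi : i' = i
    · subst hi; simpa [State.setArr] using hv
    · simpa [State.setArr, hi] using h.2 a' i'
  · simpa [State.setArr, ha] using h.2 a' i'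

/-- `Reaches M k p s Q`: started in `s`, all of whose numbers have at most `M` digits, the program
`p` halts after at most `k` instructions and tests on such numbers, in a state that satisfies `Q`. -/
def Reaches (M k : ℕ) (p : Program) (s : State) (Q : State → Prop) : Prop :=
  -- An instruction handles at most three numbers of at most `M` digits each, so it costs at most `3
  -- * M + 1`.
  s.Bdd M → ∃ t s', Exec p s t s' ∧ t ≤ k * (3 * M + 1) ∧ s'.Bdd M ∧ Q s'

namespace Reaches

variable {M : ℕ} {s : State} {Q : State → Prop}

theorem const {r v : ℕ} (hv : v < 2 ^ M) (h : Q (s.setReg r v)) :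
    Reaches M 1 (.const r v) s Q := fun hs =>
  ⟨_, _, .const s r v, by have := Nat.size_le.mpr hv; omega, hs.setReg r hv, h⟩

theorem arith {op : Op} {r i j : ℕ} (hv : op.apply (s.reg i) (s.reg j) < 2 ^ M)
    (h : Q (s.setReg r (op.apply (s.reg i) (s.reg j)))) :
    Reaches M 1 (.arith op r i j) s Q := fun hs =>
  ⟨_, _, .arith s op r i j, by
    have := Nat.size_le.mpr hv
    have := Nat.size_le.mpr (hs.1 i)
    have := Nat.size_le.mpr (hs.1 j)
    omega, hs.setReg r hv, h⟩

theorem load {r a i : ℕ} (h : Q (s.setReg r (s.arr a (s.reg i)))) :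
    Reaches M 1 (.load r a i) s Q := fun hs =>
  ⟨_, _, .load s r a i, by
    have := Nat.size_le.mpr (hs.1 i)
    have := Nat.size_le.mpr (hs.2 a (s.reg i))
    omega, hs.setReg r (hs.2 _ _), h⟩

theorem store {a i j : ℕ} (h : Q (s.setArr a (s.reg i) (s.reg j))) :
    Reaches M 1 (.store a i j) s Q := fun hs =>
  ⟨_, _, .store s a i j, by
    have := Nat.size_le.mpr (hs.1 i)
    have := Nat.size_le.mpr (hs.1 j)
    omega, hs.setArr a _ (hs.1 _), h⟩

theorem seq {p q : Program} {k l : ℕ} (h : Reaches M k p s fun s₁ => Reaches M l q s₁ Q) :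
    Reaches M (k + l) (.seq p q) s Q := by
  intro hs
  obtain ⟨t₁, s₁, e₁, l₁, b₁, h₁⟩ := h hs
  obtain ⟨t₂, s₂, e₂, l₂, b₂, h₂⟩ := h₁ b₁
  exact ⟨_, _, .seq _ _ _ _ _ _ _ e₁ e₂, by rw [add_mul]; omega, b₂, h₂⟩

theorem mono {p : Program} {k l : ℕ} {Q' : State → Prop} (h : Reaches M k p s Q) (hk : k ≤ l)
    (hQ : ∀ s', s'.Bdd M → Q s' → Q' s') : Reaches M l p s Q' := by
  intro hs
  obtain ⟨t, s', e, l, b, h⟩ := h hs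
  exact ⟨t, s', e, l.trans (Nat.mul_le_mul_right _ hk), b, hQ _ b h⟩

/-- Induction on the number of remaining passes, which register `r` holds. Each pass costs `k` and
one test, and a last test ends the loop. -/
theorem loop {p : Program} {r k : ℕ} (N : ℕ) (Inv : ℕ → State → Prop)
    (hreg : ∀ j s, Inv j s → s.reg r = N - j)
    (step : ∀ j < N, ∀ s, Inv j s → Reaches M k p s (Inv (j + 1))) (h : Inv 0 s) :
    Reaches M (N * (k + 1) + 1) (.loop r p) s (Inv N) := by
  suffices H : ∀ d j s, j + d = N → Inv j s →
      Reaches M (d * (k + 1) + 1) (.loop r p) s (Inv N) from H N 0 s (by omega) h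
  intro d
  induction d with
  | zero =>
    intro j s hj h hs
    obtain rfl : j = N := by omega
    have h0 : s.reg r = 0 := by rw [hreg _ _ h]; omega
    exact ⟨_, _, Exec.loop_stop r p s h0, by simp [h0], hs, h⟩
  | succ d ih =>
    intro j s hj h hs
    have h0 : s.reg r ≠ 0 := by rw [hreg _ _ h]; omega
    obtain ⟨t₁, s₁, e₁, l₁, b₁, h₁⟩ := step j (by omega) s h hs
    obtain ⟨t₂, s₂, e₂, l₂, b₂, h₂⟩ := ih (j + 1) s₁ (by omega) h₁ b₁
    refine ⟨_, _, .loop_step _ _ _ _ _ _ _ h0 e₁ e₂, ?_, b₂, h₂⟩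
    have := Nat.size_le.mpr (hs.1 r)
    have e : ((d + 1) * (k + 1) + 1) * (3 * M + 1)
      = (d * (k + 1) + 1) * (3 * M + 1) + k * (3 * M + 1) + (3 * M + 1) := by ring
    omega

end Reaches

/-! ### Expressions and their compilation. -/

/-- Arithmetical expressions over registers and arrays. -/
inductive Expr : Type
  | lit (v : ℕ) : Expr
  | var (r : ℕ) : Expr
  | get (a : ℕ) (e : Expr) : Expr
  | bin (op : Op) (e₁ e₂ : Expr) : Expr

namespace Expr

def eval (s : State) : Expr → ℕ
  | lit v => v
  | var r => s.reg r
  | get a e => s.arr a (e.eval s)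
  | bin op e₁ e₂ => op.apply (e₁.eval s) (e₂.eval s)

/-- No number that arises in the evaluation of the expression has more than `M` binary digits. -/
def Fits (M : ℕ) (s : State) : Expr → Prop
  | lit v => v < 2 ^ M
  | var _ => True
  | get _ e => e.Fits M s
  | bin .add e₁ e₂ => e₁.Fits M s ∧ e₂.Fits M s ∧ e₁.eval s + e₂.eval s < 2 ^ M
  | bin .mul e₁ e₂ => e₁.Fits M s ∧ e₂.Fits M s ∧ e₁.eval s * e₂.eval s < 2 ^ M
  | bin .sub e₁ e₂ => e₁.Fits M s ∧ e₂.Fits M s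
  | bin .div e₁ e₂ => e₁.Fits M s ∧ e₂.Fits M s

theorem Fits.eval_lt {M : ℕ} {s : State} (hs : s.Bdd M) :
    ∀ {e : Expr}, e.Fits M s → e.eval s < 2 ^ M
  | lit _, h => h
  | var r, _ => hs.1 r
  | get _ _, _ => hs.2 _ _
  | bin .add _ _, h => h.2.2
  | bin .mul _ _, h => h.2.2
  | bin .sub _ _, h => (Nat.sub_le _ _).trans_lt (Fits.eval_lt hs h.1)
  | bin .div _ _, h => (Nat.div_le_self _ _).trans_lt (Fits.eval_lt hs h.1)

theorem Fits.left {M : ℕ} {s : State} {op : Op} {e₁ e₂ : Expr} (h : (bin op e₁ e₂).Fits M s) :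
    e₁.Fits M s := by cases op <;> exact h.1

theorem Fits.right {M : ℕ} {s : State} {op : Op} {e₁ e₂ : Expr} (h : (bin op e₁ e₂).Fits M s) :
    e₂.Fits M s := by
  cases op
  exacts [h.2.1, h.2, h.2.1, h.2]

/-- The number of instructions that evaluate the expression. -/
def steps : Expr → ℕ
  | lit _ => 1
  | var _ => 2
  | get _ e => e.steps + 1
  | bin _ e₁ e₂ => e₁.steps + (e₂.steps + 1)

/-- Variables live in the even registers, intermediate results in the odd ones; the value of the
expression is left in the odd register number `d`, and those below it are not used. -/
def compile : Expr → ℕ → Program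
  | lit v, d => .const (2 * d + 1) v
  | var r, d => .seq (.const (2 * d + 1) 0) (.arith .add (2 * d + 1) (2 * r) (2 * d + 1))
  | get a e, d => .seq (e.compile d) (.load (2 * d + 1) a (2 * d + 1))
  | bin op e₁ e₂, d =>
    .seq (e₁.compile d)
      (.seq (e₂.compile (d + 1)) (.arith op (2 * d + 1) (2 * d + 1) (2 * (d + 1) + 1)))

end Expr

/-- The machine state `σ` holds the variables of `s` in its even registers, and the same arrays. -/
def State.Sim (s σ : State) : Prop := (∀ r, σ.reg (2 * r) = s.reg r) ∧ σ.arr = s.arr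

/-- The first `d` odd registers of `σ` and `σ'` agree. -/
def State.Keeps (d : ℕ) (σ σ' : State) : Prop := ∀ c < d, σ'.reg (2 * c + 1) = σ.reg (2 * c + 1)

theorem State.Sim.temp {s σ : State} (h : s.Sim σ) (d v : ℕ) :
    s.Sim (σ.setReg (2 * d + 1) v) :=
  ⟨fun r => by
    have : 2 * r ≠ 2 * d + 1 := by omega
    simpa [State.setReg, this] using h.1 r, h.2⟩

theorem State.Sim.var {s σ : State} (h : s.Sim σ) (r v : ℕ) :
    (s.setReg r v).Sim (σ.setReg (2 * r) v) :=
  ⟨fun r' => by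
    by_cases hr : r' = r
    · simp [State.setReg, hr]
    · simpa [State.setReg, hr] using h.1 r', h.2⟩

theorem State.Keeps.refl (d : ℕ) (σ : State) : State.Keeps d σ σ := fun _ _ => rfl

theorem State.Keeps.temp {d d' : ℕ} {σ σ' : State} (h : State.Keeps d σ σ') (hd : d ≤ d') (v : ℕ) :
    State.Keeps d σ (σ'.setReg (2 * d' + 1) v) := fun c hc => by
  have : 2 * c + 1 ≠ 2 * d' + 1 := by omega
  simpa [State.setReg, this, show c ≠ d' by omega] using h c hc

theorem State.Keeps.var {d : ℕ} {σ σ' : State} (h : State.Keeps d σ σ') (r v : ℕ) :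
    State.Keeps d σ (σ'.setReg (2 * r) v) := fun c hc => by
  have : 2 * c + 1 ≠ 2 * r := by omega
  simpa [State.setReg, this] using h c hc

theorem State.Keeps.trans {d d' : ℕ} {σ σ' σ'' : State} (h : State.Keeps d σ σ')
    (h' : State.Keeps d' σ' σ'') (hd : d ≤ d') : State.Keeps d σ σ'' := fun c hc =>
  (h' c (hc.trans_le hd)).trans (h c hc)

@[simp] theorem State.setReg_reg_self (s : State) (r v : ℕ) : (s.setReg r v).reg r = v := by
  simp [State.setReg]

theorem State.setReg_reg_ne (s : State) {r r' : ℕ} (v : ℕ) (h : r' ≠ r) :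
    (s.setReg r v).reg r' = s.reg r' := by simp [State.setReg, h]

/-- The second operand is evaluated one level higher than the first, so `State.Keeps` guarantees
that the value of the first survives. For this the induction has to cover all levels `d`. -/
theorem Expr.compile_reaches {M : ℕ} {s : State} (hs : s.Bdd M) (e : Expr) :
    ∀ (d : ℕ) (σ : State), s.Sim σ → e.Fits M s → Reaches M e.steps (e.compile d) σ fun σ' =>
      s.Sim σ' ∧ State.Keeps d σ σ' ∧ σ'.reg (2 * d + 1) = e.eval s := by
  induction e with
  | lit v =>
    intro d σ hσ hf
    exact .const hf ⟨hσ.temp _ _, (State.Keeps.refl d σ).temp le_rfl _, by simp [eval]⟩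
  | var r =>
    intro d σ hσ _
    have hr : (σ.setReg (2 * d + 1) 0).reg (2 * r) = s.reg r := by
      rw [State.setReg_reg_ne _ _ (by omega), hσ.1]
    have hv : Op.add.apply ((σ.setReg (2 * d + 1) 0).reg (2 * r))
        ((σ.setReg (2 * d + 1) 0).reg (2 * d + 1)) = s.reg r := by
      rw [hr]; simp [Op.apply]
    refine Reaches.seq (k := 1) (l := 1) (.const (Nat.two_pow_pos M) (.arith ?_ ?_))
    · rw [hv]; exact hs.1 r
    · rw [hv]
      exact ⟨(hσ.temp _ _).temp _ _,
        ((State.Keeps.refl d σ).temp le_rfl _).temp le_rfl _, by simp [eval]⟩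
  | get a e ih =>
    intro d σ hσ hf
    refine Reaches.seq ((ih d σ hσ hf).mono le_rfl ?_)
    rintro σ₁ - ⟨h₁, k₁, v₁⟩
    refine .load ⟨h₁.temp _ _, k₁.temp le_rfl _, ?_⟩
    simp [eval, v₁, h₁.2]
  | bin op e₁ e₂ ih₁ ih₂ =>
    intro d σ hσ hf
    refine Reaches.seq ((ih₁ d σ hσ hf.left).mono le_rfl ?_)
    rintro σ₁ - ⟨h₁, k₁, v₁⟩
    refine Reaches.seq ((ih₂ (d + 1) σ₁ h₁ hf.right).mono le_rfl ?_)
    rintro σ₂ - ⟨h₂, k₂, v₂⟩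
    have hv : op.apply (σ₂.reg (2 * d + 1)) (σ₂.reg (2 * (d + 1) + 1))
        = (bin op e₁ e₂).eval s := by
      rw [v₂, k₂ d (by omega), v₁]; rfl
    refine .arith ?_ ?_
    · rw [hv]; exact hf.eval_lt hs
    · rw [hv]
      exact ⟨h₂.temp _ _, (k₁.trans k₂ (by omega)).temp le_rfl _, by simp⟩

/-! ### Commands with counting loops and their compilation. -/

/-- Commands: assignments to a register and to a cell of an array, sequences, and loops in which a
register counts the passes, as many as an expression says in advance. -/
inductive Cmd : Type
  | set (r : ℕ) (e : Expr) : Cmd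
  | put (a : ℕ) (e₁ e₂ : Expr) : Cmd
  | seq (c₁ c₂ : Cmd) : Cmd
  | rep (i : ℕ) (e : Expr) (c : Cmd) : Cmd

namespace Cmd

def run : Cmd → State → State
  | set r e, s => s.setReg r (e.eval s)
  | put a e₁ e₂, s => s.setArr a (e₁.eval s) (e₂.eval s)
  | seq c₁ c₂, s => c₂.run (c₁.run s)
  | rep i e c, s => Nat.rec s (fun j s' => c.run (s'.setReg i j)) (e.eval s)

/-- The state before pass number `j` of a loop. -/
def iter (i : ℕ) (c : Cmd) (s : State) (j : ℕ) : State :=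
  Nat.rec s (fun j s' => c.run (s'.setReg i j)) j

/-- No number that arises has more than `M` binary digits, and no loop more than `L` passes. -/
def Fits (M L : ℕ) : Cmd → State → Prop
  | set _ e, s => e.Fits M s
  | put _ e₁ e₂, s => e₁.Fits M s ∧ e₂.Fits M s
  | seq c₁ c₂, s => c₁.Fits M L s ∧ c₂.Fits M L (c₁.run s)
  | rep i e c, s => e.Fits M s ∧ e.eval s ≤ L ∧
      ∀ j < e.eval s, c.Fits M L ((iter i c s j).setReg i j)

/-- A polynomial in the number of passes that bounds the number of instructions and tests. -/
noncomputable def steps : Cmd → Polynomial ℕ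
  | set _ e => .C (e.steps + 2)
  | put _ e₁ e₂ => .C (e₁.steps + (e₂.steps + 1))
  | seq c₁ c₂ => c₁.steps + c₂.steps
  | rep _ e c => .C (e.steps + 2) + .X * (c.steps + .C 6)

def compile : Cmd → ℕ → Program
  | set r e, d =>
    .seq (e.compile d) (.seq (.const (2 * (d + 1) + 1) 0)
      (.arith .add (2 * r) (2 * d + 1) (2 * (d + 1) + 1)))
  | put a e₁ e₂, d =>
    .seq (e₁.compile d) (.seq (e₂.compile (d + 1)) (.store a (2 * d + 1) (2 * (d + 1) + 1)))
  | seq c₁ c₂, d => .seq (c₁.compile d) (c₂.compile d)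
  | rep i e c, d =>
    .seq (e.compile d) (.seq (.const (2 * (d + 1) + 1) 0)
      (.loop (2 * d + 1)
        (.seq (.const (2 * (d + 2) + 1) 0)
        (.seq (.arith .add (2 * i) (2 * (d + 1) + 1) (2 * (d + 2) + 1))
        (.seq (c.compile (d + 2))
        (.seq (.const (2 * (d + 2) + 1) 1)
        (.seq (.arith .add (2 * (d + 1) + 1) (2 * (d + 1) + 1) (2 * (d + 2) + 1))
          (.arith .sub (2 * d + 1) (2 * d + 1) (2 * (d + 2) + 1)))))))))

end Cmd

theorem State.Sim.bdd {M : ℕ} {s σ : State} (h : s.Sim σ) (hσ : σ.Bdd M) : s.Bdd M :=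
  ⟨fun r => h.1 r ▸ hσ.1 _, fun a i => h.2 ▸ hσ.2 a i⟩

/-- Simulation by induction on the command. A loop reserves two odd registers, one for the passes
left and one for the index of the pass. Its body is compiled two levels higher and hence keeps both,
even if it overwrites the loop variable. -/
theorem Cmd.compile_reaches {M L : ℕ} (c : Cmd) :
    ∀ (d : ℕ) (s σ : State), s.Sim σ → c.Fits M L s →
      Reaches M (c.steps.eval L) (c.compile d) σ fun σ' =>
        (c.run s).Sim σ' ∧ State.Keeps d σ σ' := by
  induction c with
  | set r e =>
    intro d s σ hσ hf hb
    -- The bound on the machine state, a premise inside `Reaches`, also bounds the simulated state;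
    -- it is then put back into the goal.
    have hs := hσ.bdd hb
    revert hb
    have e2 : (set r e).steps.eval L = e.steps + (1 + 1) := by simp [steps]
    rw [e2]
    refine Reaches.seq ((e.compile_reaches hs d σ hσ hf).mono le_rfl ?_)
    rintro σ₁ - ⟨h₁, k₁, v₁⟩
    refine Reaches.seq (.const (Nat.two_pow_pos M) (.arith ?_ ?_)) <;>
      rw [State.setReg_reg_self, State.setReg_reg_ne _ _ (by omega), v₁]
    · exact Expr.Fits.eval_lt hs hf
    · exact ⟨(h₁.temp _ _).var _ _, (k₁.temp (by omega) _).var _ _⟩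
  | put a e₁ e₂ =>
    intro d s σ hσ hf hb
    have hs := hσ.bdd hb
    revert hb
    have e2 : (put a e₁ e₂).steps.eval L = e₁.steps + (e₂.steps + 1) := by simp [steps]
    rw [e2]
    refine Reaches.seq ((e₁.compile_reaches hs d σ hσ hf.1).mono le_rfl ?_)
    rintro σ₁ - ⟨h₁, k₁, v₁⟩
    refine Reaches.seq ((e₂.compile_reaches hs (d + 1) σ₁ h₁ hf.2).mono le_rfl ?_)
    rintro σ₂ - ⟨h₂, k₂, v₂⟩
    refine .store ?_
    rw [v₂, k₂ d (by omega), v₁]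
    refine ⟨⟨h₂.1, ?_⟩, fun c hc => (k₁.trans k₂ (by omega)) c hc⟩
    simp [State.setArr, run, h₂.2]
  | seq c₁ c₂ ih₁ ih₂ =>
    intro d s σ hσ hf
    have e2 : (seq c₁ c₂).steps.eval L = c₁.steps.eval L + c₂.steps.eval L := by simp [steps]
    rw [e2]
    refine Reaches.seq ((ih₁ d s σ hσ hf.1).mono le_rfl ?_)
    rintro σ₁ - ⟨h₁, k₁⟩
    refine (ih₂ d _ σ₁ h₁ hf.2).mono le_rfl ?_
    rintro σ₂ - ⟨h₂, k₂⟩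
    exact ⟨h₂, k₁.trans k₂ le_rfl⟩
  | rep i e c ih =>
    intro d s σ hσ hf hb
    have hs := hσ.bdd hb
    revert hb
    obtain ⟨hfe, hL, hfc⟩ := hf
    have hN : e.eval s < 2 ^ M := hfe.eval_lt hs
    set N := e.eval s with hNdef
    refine Reaches.mono (k := e.steps + (1 + (N * ((1 + (1 + (c.steps.eval L + (1 + (1 + 1))))) + 1) + 1)))
      (Q := fun σ' => (iter i c s N).Sim σ' ∧ State.Keeps d σ σ') ?_ ?_ ?_
    · refine Reaches.seq ((e.compile_reaches hs d σ hσ hfe).mono le_rfl ?_)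
      rintro σ₁ - ⟨h₁, k₁, v₁⟩
      refine Reaches.seq (.const (Nat.two_pow_pos M) ?_)
      -- Before pass `j` register `2 * d + 1` holds the `N - j` passes left, and register `2 * (d +
      -- 1) + 1` holds `j`.
      let Inv : ℕ → State → Prop := fun j σ' => (iter i c s j).Sim σ' ∧ State.Keeps d σ σ' ∧
        σ'.reg (2 * d + 1) = N - j ∧ σ'.reg (2 * (d + 1) + 1) = j
      refine (Reaches.loop N Inv (fun j s h => h.2.2.1) ?_ ?_).mono le_rfl fun σ' _ h => ⟨h.1, h.2.1⟩
      · rintro j hj τ ⟨hτ, kτ, r1, r2⟩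
        refine Reaches.seq (.const (Nat.two_pow_pos M) ?_)
        have a1 : Op.add.apply ((τ.setReg (2 * (d + 2) + 1) 0).reg (2 * (d + 1) + 1))
            ((τ.setReg (2 * (d + 2) + 1) 0).reg (2 * (d + 2) + 1)) = j := by
          rw [State.setReg_reg_self, State.setReg_reg_ne _ _ (by omega), r2]; rfl
        refine Reaches.seq (.arith (by rw [a1]; omega) ?_)
        rw [a1]
        refine Reaches.seq ((ih (d + 2) ((iter i c s j).setReg i j) _
          ((hτ.temp _ _).var _ _) (hfc j hj)).mono le_rfl ?_)
        rintro τ₁ - ⟨hτ₁, kτ₁⟩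
        have q1 := kτ₁ d (by omega)
        have q2 := kτ₁ (d + 1) (by omega)
        rw [State.setReg_reg_ne _ _ (by omega), State.setReg_reg_ne _ _ (by omega)] at q1 q2
        refine Reaches.seq (.const (by omega) ?_)
        have a2 : Op.add.apply ((τ₁.setReg (2 * (d + 2) + 1) 1).reg (2 * (d + 1) + 1))
            ((τ₁.setReg (2 * (d + 2) + 1) 1).reg (2 * (d + 2) + 1)) = j + 1 := by
          rw [State.setReg_reg_self, State.setReg_reg_ne _ _ (by omega), q2, r2]; rfl
        refine Reaches.seq (.arith (by rw [a2]; omega) ?_)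
        rw [a2]
        have a3 : Op.sub.apply
            (((τ₁.setReg (2 * (d + 2) + 1) 1).setReg (2 * (d + 1) + 1) (j + 1)).reg (2 * d + 1))
            (((τ₁.setReg (2 * (d + 2) + 1) 1).setReg (2 * (d + 1) + 1) (j + 1)).reg
              (2 * (d + 2) + 1)) = N - (j + 1) := by
          rw [State.setReg_reg_ne _ _ (by omega), State.setReg_reg_ne _ _ (by omega),
            State.setReg_reg_ne _ _ (by omega), State.setReg_reg_self, q1, r1]
          simp only [Op.apply]; omega
        refine .arith (by rw [a3]; omega) ?_
        rw [a3]
        refine ⟨((hτ₁.temp _ _).temp _ _).temp _ _, ?_, State.setReg_reg_self _ _ _, ?_⟩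
        · exact (((((kτ.temp (by omega) _).var _ _).trans kτ₁ (by omega)).temp (by omega) _).temp
            (by omega) _).temp (by omega) _
        · rw [State.setReg_reg_ne _ _ (by omega), State.setReg_reg_self]
      · refine ⟨h₁.temp _ _, k₁.temp (by omega) _, ?_, by simp⟩
        rw [State.setReg_reg_ne _ _ (by omega), v₁]; rfl
    · have : N * (c.steps.eval L + 6) ≤ L * (c.steps.eval L + 6) := Nat.mul_le_mul_right _ hL
      simp only [steps, Polynomial.eval_add, Polynomial.eval_mul, Polynomial.eval_C,
        Polynomial.eval_X]
      have e2 : N * (1 + (1 + (c.steps.eval L + (1 + (1 + 1)))) + 1)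
        = N * (c.steps.eval L + 6) := by ring
      omega
    · exact fun σ' _ h => h

/-! ### From commands to polynomial time. -/

theorem initialState_sim (w : List ℕ) : (initialState w).Sim (initialState w) :=
  ⟨fun r => by simp [initialState], rfl⟩

theorem size_le_inputLength {w : List ℕ} {v : ℕ} (hv : v ∈ w) : v.size + 1 ≤ inputLength w :=
  List.le_sum_of_mem (List.mem_map.mpr ⟨v, hv, rfl⟩)

theorem length_le_inputLength (w : List ℕ) : w.length ≤ inputLength w := by
  unfold inputLength
  induction w with
  | nil => simp
  | cons v w ih => simp only [List.map_cons, List.sum_cons, List.length_cons]; omega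

theorem initialState_bdd {w : List ℕ} {M : ℕ} (h : inputLength w ≤ M) :
    (initialState w).Bdd M := by
  have h2 : ∀ v : ℕ, v ≤ M → v < 2 ^ M := fun v hv => hv.trans_lt Nat.lt_two_pow_self
  refine ⟨fun r => ?_, fun a i => ?_⟩
  · simp only [initialState]
    split
    · exact h2 _ ((length_le_inputLength w).trans h)
    · exact Nat.two_pow_pos M
  · simp only [initialState]
    split
    · by_cases hi : i < w.length
      · rw [List.getD_eq_getElem _ _ hi]
        have := size_le_inputLength (List.getElem_mem hi)
        exact Nat.size_le.mp (by omega)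
      · rw [List.getD_eq_default _ _ (by omega)]; exact Nat.two_pow_pos M
    · exact Nat.two_pow_pos M

/-- Functions that a command computes with numbers of polynomial length and loops of linearly many
passes are computable in polynomial time. The variables `0`, `2`, `1` hold the sign, the numerator
and the denominator of the result. -/
theorem polyTimeComputable_of_cmd {I : Type} {P : I → Prop} {enc : I → List ℕ} {f : I → ℚ}
    (c : Cmd) (M : Polynomial ℕ) (hM : ∀ l, l ≤ M.eval l)
    (h : ∀ i, P i →
      c.Fits (M.eval (inputLength (enc i))) (inputLength (enc i)) (initialState (enc i)) ∧
      (c.run (initialState (enc i))).reg 1 ≠ 0 ∧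
      f i = (-1) ^ (c.run (initialState (enc i))).reg 0 *
        ((c.run (initialState (enc i))).reg 2 : ℚ) / ((c.run (initialState (enc i))).reg 1 : ℚ)) :
    PolyTimeComputable P enc f := by
  -- Variables `0` and `1` already lie in the registers `0` and `2` of the output format. Variable
  -- `2`, the numerator, lies in register `4` and is copied to register `1` by adding zero.
  refine ⟨.seq (c.compile 0) (.seq (.const 3 0) (.arith .add 1 4 3)),
    (c.steps + .C 2) * (3 * M + 1), fun i hi => ?_⟩
  obtain ⟨hf, h1, h2⟩ := h i hi
  set L := inputLength (enc i)
  set s := initialState (enc i)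
  have : Reaches (M.eval L) (c.steps.eval L + (1 + 1))
      (.seq (c.compile 0) (.seq (.const 3 0) (.arith .add 1 4 3))) s fun σ => σ.HoldsRat (f i) := by
    refine Reaches.seq ((c.compile_reaches 0 s s (initialState_sim _) hf).mono le_rfl ?_)
    rintro σ hb ⟨hσ, -⟩
    have e0 := hσ.1 0
    have e1 := hσ.1 1
    have e2 := hσ.1 2
    have a1 : Op.add.apply ((σ.setReg 3 0).reg 4) ((σ.setReg 3 0).reg 3) = (c.run s).reg 2 := by
      rw [State.setReg_reg_self, State.setReg_reg_ne _ _ (by omega), ← e2]; rfl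
    refine Reaches.seq (.const (Nat.two_pow_pos _) (.arith ?_ ?_)) <;> rw [a1]
    · rw [← e2]; exact hb.1 _
    · refine ⟨?_, ?_⟩ <;>
        simp only [State.setReg_reg_self, State.setReg_reg_ne _ _ (show (2 : ℕ) ≠ 1 by omega),
          State.setReg_reg_ne _ _ (show (2 : ℕ) ≠ 3 by omega),
          State.setReg_reg_ne _ _ (show (0 : ℕ) ≠ 1 by omega),
          State.setReg_reg_ne _ _ (show (0 : ℕ) ≠ 3 by omega)]
      · rw [e1]; exact h1
      · rw [e1, e0]; exact h2
  obtain ⟨t, σ, e, ht, -, hσ⟩ := this (initialState_bdd (hM _))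
  exact ⟨t, σ, e, by simpa using ht, hσ⟩

/-- The command fits the bounds and leads to a state that satisfies `Q`. -/
def Cmd.Ok (M L : ℕ) (c : Cmd) (s : State) (Q : State → Prop) : Prop :=
  c.Fits M L s ∧ Q (c.run s)

namespace Cmd.Ok

variable {M L : ℕ} {s : State} {Q : State → Prop}

theorem set {r : ℕ} {e : Expr} (hf : e.Fits M s) (h : Q (s.setReg r (e.eval s))) :
    (Cmd.set r e).Ok M L s Q := ⟨hf, h⟩

theorem put {a : ℕ} {e₁ e₂ : Expr} (h₁ : e₁.Fits M s) (h₂ : e₂.Fits M s)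
    (h : Q (s.setArr a (e₁.eval s) (e₂.eval s))) : (Cmd.put a e₁ e₂).Ok M L s Q := ⟨⟨h₁, h₂⟩, h⟩

theorem seq {c₁ c₂ : Cmd} (h : c₁.Ok M L s fun s' => c₂.Ok M L s' Q) :
    (Cmd.seq c₁ c₂).Ok M L s Q := ⟨⟨h.1, h.2.1⟩, h.2.2⟩

theorem mono {c : Cmd} {Q' : State → Prop} (h : c.Ok M L s Q) (hQ : ∀ s', Q s' → Q' s') :
    c.Ok M L s Q' := ⟨h.1, hQ _ h.2⟩

/-- The invariant speaks of the state before the loop variable is written, so the body may leave any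
value in that variable. -/
theorem rep {i : ℕ} {e : Expr} {c : Cmd} (N : ℕ) (Inv : ℕ → State → Prop) (hf : e.Fits M s)
    (hN : e.eval s = N) (hL : N ≤ L) (h0 : Inv 0 s)
    (step : ∀ j < N, ∀ s, Inv j s → c.Ok M L (s.setReg i j) (Inv (j + 1)))
    (hQ : ∀ s, Inv N s → Q s) :
    (Cmd.rep i e c).Ok M L s Q := by
  have key : ∀ j ≤ N, Inv j (iter i c s j) := by
    intro j
    induction j with
    | zero => exact fun _ => h0
    | succ j ih => exact fun hj => (step j (by omega) _ (ih (by omega))).2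
  subst hN
  exact ⟨⟨hf, hL, fun j hj => (step j hj _ (key j hj.le)).1⟩, hQ _ (key _ le_rfl)⟩

end Cmd.Ok

/-! ### Weighted model counting -/

section WMC

variable {n : ℕ} (a b : Fin n → ℕ)

/-- The weight of an entity: the product of the weights `a y` of the features `y` that it has and
`b y` of those that it does not have. -/
def weight (e : Fin n → Bool) : ℕ := ∏ y, if e y = true then a y else b y

/-- The weighted number of the entities that `f` accepts. -/
def wmc (f : (Fin n → Bool) → Bool) : ℕ := ∑ e, if f e = true then weight a b e else 0

/-- The weight of all entities. -/
def totalWeight : ℕ := ∏ y, (a y + b y)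

theorem sum_weight : ∑ e, weight a b e = totalWeight a b := by
  unfold weight totalWeight
  have h : ∀ y, a y + b y = ∑ v : Bool, if v = true then a y else b y := by simp
  simp_rw [h, Finset.prod_univ_sum, Fintype.piFinset_univ]

theorem wmc_true : wmc a b (fun _ => true) = totalWeight a b := by
  simp [wmc, sum_weight]

theorem wmc_false : wmc a b (fun _ => false) = 0 := by simp [wmc]

theorem wmc_le (f : (Fin n → Bool) → Bool) : wmc a b f ≤ totalWeight a b := by
  rw [← sum_weight]
  refine Finset.sum_le_sum fun e _ => ?_
  split <;> simp

theorem wmc_or {f g h : (Fin n → Bool) → Bool} (hh : ∀ e, h e = (f e || g e))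
    (hd : ∀ e, ¬ (f e = true ∧ g e = true)) : wmc a b h = wmc a b f + wmc a b g := by
  unfold wmc
  rw [← Finset.sum_add_distrib]
  refine Finset.sum_congr rfl fun e _ => ?_
  have h' := hd e
  rw [hh e]
  generalize f e = p at *
  generalize g e = q at *
  cases p <;> cases q <;> simp at h' ⊢

theorem wmc_not {f h : (Fin n → Bool) → Bool} (hh : ∀ e, h e = !f e) :
    wmc a b h = totalWeight a b - wmc a b f := by
  have := wmc_or a b (f := f) (g := h) (h := fun _ => true) (fun e => by rw [hh]; simp)
    (fun e => by rw [hh]; simp)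
  rw [wmc_true] at this
  omega

/-- Events that depend on disjoint sets of features are independent. -/
theorem wmc_and {f g h : (Fin n → Bool) → Bool} {S : Set (Fin n)} (hf : DependsOn f S)
    (hg : DependsOn g Sᶜ) (hh : ∀ e, h e = (f e && g e)) :
    wmc a b h * totalWeight a b = wmc a b f * wmc a b g := by
  classical
  -- The factor `totalWeight a b` brings in a second, independent entity. Exchanging the parts of
  -- two entities outside `S` is an involution on pairs that preserves the product of the weights,
  -- and it turns `f e && g e` into a condition `f` on one entity and `g` on the other.
  let mix : (Fin n → Bool) → (Fin n → Bool) → (Fin n → Bool) := fun e e' y =>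
    if y ∈ S then e y else e' y
  have hmm : ∀ e e', mix (mix e e') (mix e' e) = e := fun e e' => by
    funext y; by_cases hy : y ∈ S <;> simp [mix, hy]
  let sw : Equiv.Perm ((Fin n → Bool) × (Fin n → Bool)) :=
    { toFun := fun p => (mix p.1 p.2, mix p.2 p.1)
      invFun := fun p => (mix p.1 p.2, mix p.2 p.1)
      left_inv := fun p => by simp [hmm]
      right_inv := fun p => by simp [hmm] }
  have hw : ∀ e e', weight a b (mix e e') * weight a b (mix e' e)
      = weight a b e * weight a b e' := fun e e' => by
    unfold weight
    rw [← Finset.prod_mul_distrib, ← Finset.prod_mul_distrib]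
    refine Finset.prod_congr rfl fun y _ => ?_
    by_cases hy : y ∈ S <;> simp [mix, hy, mul_comm]
  have h1 : ∀ e e', f (mix e e') = f e := fun e e' => hf fun y hy => by simp [mix, hy]
  have h2 : ∀ e e', g (mix e e') = g e' := fun e e' => hg fun y hy => by
    have : y ∉ S := hy
    simp [mix, this]
  rw [← sum_weight]
  unfold wmc
  rw [Finset.sum_mul_sum, Finset.sum_mul_sum, ← Finset.sum_product', ← Finset.sum_product',
    Finset.univ_product_univ, ← Equiv.sum_comp sw]
  refine Finset.sum_congr rfl fun p _ => ?_
  change (if h (mix p.1 p.2) = true then weight a b (mix p.1 p.2) else 0)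
    * weight a b (mix p.2 p.1) = _
  rw [hh, h1, h2]
  cases f p.1 <;> cases g p.2 <;> simp [hw]

/-- Replacing `b y` by `0` annihilates exactly the entities without `y`, so the count is a total
weight in which the factor `a y + b y` has become `a y`. -/
theorem wmc_var (y : Fin n) :
    wmc a b (fun e => e y) * (a y + b y) = totalWeight a b * a y := by
  have h : wmc a b (fun e => e y) = totalWeight a (Function.update b y 0) := by
    rw [← sum_weight]
    refine Finset.sum_congr rfl fun e _ => ?_
    unfold weight
    split
    · rename_i hy
      refine Finset.prod_congr rfl fun z _ => ?_
      by_cases hz : z = y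
      · subst hz; simp [hy]
      · simp [hz]
    · rename_i hy
      exact (Finset.prod_eq_zero (Finset.mem_univ y) (by simp [hy])).symm
  rw [h]
  unfold totalWeight
  rw [← Finset.mul_prod_erase _ _ (Finset.mem_univ y),
    ← Finset.mul_prod_erase _ (fun z => a z + b z) (Finset.mem_univ y)]
  have : ∏ z ∈ Finset.univ.erase y, (a z + Function.update b y 0 z)
      = ∏ z ∈ Finset.univ.erase y, (a z + b z) :=
    Finset.prod_congr rfl fun z hz => by simp [Finset.ne_of_mem_erase hz]
  rw [this]
  simp only [Function.update_self, add_zero]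
  ring

/-- The accepted entities split according to their value at `y`. On either side the condition on `y`
is independent of `f` or `g`, so `wmc_and` applies, and the positive total weight is cancelled at
the end. -/
theorem wmc_branch {f g h : (Fin n → Bool) → Bool} {y : Fin n} (hpos : 0 < totalWeight a b)
    (hf : DependsOn f {y}ᶜ) (hg : DependsOn g {y}ᶜ)
    (hh : ∀ e, h e = if e y = true then g e else f e) :
    wmc a b h * (a y + b y) = wmc a b f * b y + wmc a b g * a y := by
  have hd : DependsOn (fun e : Fin n → Bool => e y) {y} := fun e e' h => h y rfl
  have hd' : DependsOn (fun e : Fin n → Bool => !e y) {y} := fun e e' h => by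
    simp only [h y rfl]
  have h1 := wmc_and a b (h := fun e => e y && g e) hd hg fun _ => rfl
  have h2 := wmc_and a b (h := fun e => (!e y) && f e) hd' hf fun _ => rfl
  have h3 := wmc_or a b (f := fun e => (!e y) && f e) (g := fun e => e y && g e) (h := h)
    (fun e => by rw [hh]; cases e y <;> simp) (fun e => by cases e y <;> simp)
  have h4 := wmc_var a b y
  have h5 : wmc a b (fun _ => true) = wmc a b (fun e => e y) + wmc a b (fun e => !e y) :=
    wmc_or a b (fun e => by simp) (fun e => by simp)
  rw [wmc_true] at h5
  refine Nat.eq_of_mul_eq_mul_right hpos ?_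
  zify at *
  rw [h3]
  linear_combination (a y + b y : ℤ) * (h1 + h2) + wmc a b g * h4
    - wmc a b f * h4 - wmc a b f * (a y + b y) * h5

end WMC

/-! ### The SHAP-score as a sum over the entities that are accepted -/

section Formula

variable {n : ℕ}

/-- The consistent entities form a product with one choice on `S` and two elsewhere. -/
theorem card_cw (e : Fin n → Bool) (S : Finset (Fin n)) :
    (cw e S).card * 2 ^ S.card = 2 ^ n := by
  have h : cw e S = Fintype.piFinset fun y => if y ∈ S then {e y} else Finset.univ := by
    ext e'
    simp only [cw, Finset.mem_filter, Finset.mem_univ, true_and, Fintype.mem_piFinset]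
    refine forall_congr' fun y => ?_
    by_cases hy : y ∈ S <;> simp [hy]
  have h2 : ∀ y, (if y ∈ S then {e y} else (Finset.univ : Finset Bool)).card
      = if y ∈ S then 1 else 2 := fun y => by split <;> simp
  rw [h, Fintype.card_piFinset]
  simp_rw [h2]
  have h3 : (2 : ℕ) ^ S.card = ∏ y, if y ∈ S then 2 else 1 := by
    rw [Finset.prod_ite_mem]; simp
  rw [h3, ← Finset.prod_mul_distrib]
  have h4 : ∀ y, ((if y ∈ S then 1 else 2) * if y ∈ S then 2 else 1) = 2 := fun y => by
    split <;> rfl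
  simp [h4]

/-- The sum runs over all entities, whatever `S` is, so that it can later be exchanged with the sum
over `S`. -/
theorem phi_eq (M : (Fin n → Bool) → Bool) (e : Fin n → Bool) (S : Finset (Fin n)) :
    phi M e S = 2 ^ S.card / 2 ^ n *
      ∑ e', if M e' = true ∧ (∀ y ∈ S, e' y = e y) then (1 : ℚ) else 0 := by
  have h1 : ((cw e S).card : ℚ) = 2 ^ n / 2 ^ S.card := by
    rw [eq_div_iff (by positivity)]; exact_mod_cast card_cw e S
  have h2 : ∑ e' ∈ cw e S, (if M e' = true then (1 : ℚ) else 0)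
      = ∑ e', if M e' = true ∧ (∀ y ∈ S, e' y = e y) then (1 : ℚ) else 0 := by
    rw [cw, Finset.sum_filter]
    refine Finset.sum_congr rfl fun e' _ => ?_
    by_cases h : ∀ y ∈ S, e' y = e y
    · simp only [eq_true h, and_true, if_true]
    · simp only [eq_false h, and_false, if_false]
  simp only [phi, condExpectation, prob, Finset.card_singleton, Fintype.card_fin]
  rw [← Finset.sum_mul, h2, h1]
  field_simp
  simp

/-- The number of features other than `x` on which the entities agree. -/
def agreement (e : Fin n → Bool) (x : Fin n) (e' : Fin n → Bool) : ℕ :=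
  ((Finset.univ.erase x).filter fun y => e' y = e y).card

theorem agreement_lt (e : Fin n → Bool) (x : Fin n) (e' : Fin n → Bool) :
    agreement e x e' < n := by
  have := x.pos
  have h := Finset.card_filter_le (Finset.univ.erase x) fun y => e' y = e y
  rw [Finset.card_erase_of_mem (Finset.mem_univ x), Finset.card_univ, Fintype.card_fin] at h
  unfold agreement
  omega

/-- The contribution, up to the sign and the factor `n! * 2 ^ n`, of an entity with agreement `k`. -/
def contribution (n k : ℕ) : ℕ :=
  ∑ j ∈ Finset.range (k + 1), k.descFactorial j * (n - 1 - j).factorial * 2 ^ j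

theorem contribution_zero (n : ℕ) : contribution n 0 = (n - 1).factorial := by
  simp [contribution]

/-- This recurrence lets the program obtain each contribution from the preceding one. With `u j` the
summands on the left, one weighted sum of the `u j` telescopes and another is, after an index shift,
the preceding contribution; the two weights add up to a constant. -/
theorem contribution_succ {n k : ℕ} (hk : k + 1 < n) :
    contribution n (k + 1) * (n - 1 - k) = n.factorial + (k + 1) * contribution n k := by
  let u : ℕ → ℕ := fun j => (k + 1).descFactorial j * (n - 1 - j).factorial * 2 ^ j
  have step : ∀ j < n - 1, u (j + 1) * (n - 1 - j) = 2 * (k + 1 - j) * u j := by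
    intro j hj
    have h1 : (n - 1 - j).factorial = (n - 1 - j) * (n - 1 - (j + 1)).factorial := by
      obtain ⟨d, hd⟩ : ∃ d, n - 1 - j = d + 1 := ⟨n - 1 - j - 1, by omega⟩
      rw [hd, show n - 1 - (j + 1) = d by omega, Nat.factorial_succ]
    simp only [u]
    rw [h1, Nat.descFactorial_succ, pow_succ]
    ring
  have u0 : (u 0 : ℤ) * n = n.factorial := by
    obtain ⟨d, rfl⟩ : ∃ d, n = d + 1 := ⟨n - 1, by omega⟩
    simp only [u]
    push_cast [Nat.factorial_succ]
    simp
    ring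
  -- By `step` the summand is `u j * (n - j) - u (j + 1) * (n - (j + 1))`.
  have tel : ∀ J ≤ k + 1, ∑ j ∈ Finset.range J, (u j : ℤ) * (n - 2 * (k + 1) + j)
      = u 0 * n - u J * (n - J) := by
    intro J
    induction J with
    | zero => simp
    | succ J ih =>
      intro hJ
      have h := step J (by omega)
      zify [show J ≤ n - 1 by omega, show 1 ≤ n by omega, show J ≤ k + 1 by omega] at h
      rw [Finset.sum_range_succ, ih (by omega)]
      push_cast
      linear_combination h
  -- The last summand, with `j = k + 1`, has the factor `n - (k + 1)` and cancels the boundary term.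
  have full : ∑ j ∈ Finset.range (k + 2), (u j : ℤ) * (n - 2 * (k + 1) + j) = u 0 * n := by
    rw [Finset.sum_range_succ, tel _ le_rfl]
    push_cast
    ring
  have rel : 2 * ((k + 1 : ℤ) * contribution n k)
      = ∑ j ∈ Finset.range (k + 2), (u j : ℤ) * (n - j) - u 0 * n := by
    rw [Finset.sum_range_succ']
    simp only [contribution]
    push_cast
    rw [Finset.mul_sum, Finset.mul_sum, sub_zero, add_sub_cancel_right]
    refine Finset.sum_congr rfl fun j hj => ?_
    have hj := Finset.mem_range.mp hj
    have h1 : (n - 1 - j).factorial = (n - 1 - j) * (n - 1 - (j + 1)).factorial := by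
      obtain ⟨d, hd⟩ : ∃ d, n - 1 - j = d + 1 := ⟨n - 1 - j - 1, by omega⟩
      rw [hd, show n - 1 - (j + 1) = d by omega, Nat.factorial_succ]
    simp only [u]
    rw [h1, Nat.succ_descFactorial_succ]
    push_cast [show j ≤ n - 1 by omega, show 1 ≤ n by omega]
    ring
  have hV : (contribution n (k + 1) : ℤ) = ∑ j ∈ Finset.range (k + 2), (u j : ℤ) := by
    simp only [contribution, u]; push_cast; rfl
  -- The coefficients `n - 2 * (k + 1) + j` and `n - j` add up to `2 * (n - 1 - k)`, independently
  -- of `j`.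
  have e1 : ∑ j ∈ Finset.range (k + 2), (u j : ℤ) * (n - 2 * (k + 1) + j)
      + ∑ j ∈ Finset.range (k + 2), (u j : ℤ) * (n - j)
      = 2 * ((n - 1 - k) * ∑ j ∈ Finset.range (k + 2), (u j : ℤ)) := by
    rw [← Finset.sum_add_distrib, Finset.mul_sum, Finset.mul_sum]
    exact Finset.sum_congr rfl fun j _ => by ring
  zify [show k ≤ n - 1 by omega, show 1 ≤ n by omega]
  rw [hV]
  linarith

theorem contribution_le {n k : ℕ} (hk : k < n) : contribution n k ≤ n * (n ^ n * n ^ n * 2 ^ n) := by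
  have h : ∀ j ∈ Finset.range (k + 1),
      k.descFactorial j * (n - 1 - j).factorial * 2 ^ j ≤ n ^ n * n ^ n * 2 ^ n := by
    intro j hj
    have hj := Finset.mem_range.mp hj
    have hn : 0 < n := by omega
    refine Nat.mul_le_mul (Nat.mul_le_mul ?_ ?_) (Nat.pow_le_pow_right (by omega) (by omega))
    · exact (Nat.descFactorial_le_pow k j).trans ((Nat.pow_le_pow_left hk.le j).trans
        (Nat.pow_le_pow_right hn (by omega)))
    · exact (Nat.factorial_le (by omega)).trans (Nat.factorial_le_pow n)
  refine (Finset.sum_le_card_nsmul _ _ _ h).trans ?_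
  rw [Finset.card_range, smul_eq_mul]
  exact Nat.mul_le_mul_right _ hk

/-- Fixing `x` as well doubles the weight of the entities that agree on `x` and discards the others,
so an accepted `e'` consistent with `S` contributes `2 - 1` or `0 - 1` to the difference. After
exchanging the sums, the relevant `S` for a given `e'` are the subsets of its agreement set, and
they are grouped by size. -/
theorem shap_eq (M : (Fin n → Bool) → Bool) (e : Fin n → Bool) (x : Fin n) :
    shap M e x * (n.factorial * 2 ^ n) =
      ∑ e', if M e' = true then
        (if e' x = e x then (1 : ℚ) else -1) * contribution n (agreement e x e') else 0 := by
  have hphi : ∀ S ∈ (Finset.univ.erase x).powerset, phi M e (insert x S) - phi M e S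
      = 2 ^ S.card / 2 ^ n * ∑ e', (if M e' = true ∧ (∀ y ∈ S, e' y = e y) then
          (if e' x = e x then (1 : ℚ) else -1) else 0) := by
    intro S hS
    have hx : x ∉ S := fun h => Finset.notMem_erase x _ (Finset.mem_powerset.mp hS h)
    rw [phi_eq, phi_eq, Finset.card_insert_of_notMem hx, pow_succ, mul_div_right_comm, mul_assoc,
      ← mul_sub, Finset.mul_sum, ← Finset.sum_sub_distrib]
    congr 1
    refine Finset.sum_congr rfl fun e' _ => ?_
    simp only [Finset.forall_mem_insert]
    by_cases h3 : ∀ y ∈ S, e' y = e y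
    · have h4 := eq_true h3
      by_cases h1 : M e' = true <;> by_cases h2 : e' x = e x <;>
        simp only [h1, h2, h4, and_self, and_true, and_false, if_true, if_false,
          Bool.false_eq_true] <;> norm_num
    · have h4 := eq_false h3
      simp only [h4, and_false, if_false, mul_zero, sub_zero]
  have hn : (n.factorial : ℚ) ≠ 0 := by exact_mod_cast n.factorial_ne_zero
  unfold shap
  rw [Finset.sum_mul]
  have : ∀ S ∈ (Finset.univ.erase x).powerset,
      ((S.card.factorial : ℚ) * ((Fintype.card (Fin n) - S.card - 1).factorial : ℚ)
        / ((Fintype.card (Fin n)).factorial : ℚ)) * (phi M e (insert x S) - phi M e S)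
        * (n.factorial * 2 ^ n)
      = ∑ e', if M e' = true ∧ (∀ y ∈ S, e' y = e y) then
          (if e' x = e x then (1 : ℚ) else -1) *
            (S.card.factorial * (n - 1 - S.card).factorial * 2 ^ S.card) else 0 := by
    intro S hS
    rw [hphi S hS, Fintype.card_fin, show n - S.card - 1 = n - 1 - S.card by omega]
    have e1 : ∀ A B C s : ℚ, A * B / n.factorial * (C / 2 ^ n * s) * (n.factorial * 2 ^ n)
        = s * (A * B * C) := fun A B C s => by field_simp
    rw [e1, Finset.sum_mul]
    exact Finset.sum_congr rfl fun e' _ => by split <;> simp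
  rw [Finset.sum_congr rfl this, Finset.sum_comm]
  refine Finset.sum_congr rfl fun e' _ => ?_
  by_cases hM : M e' = true
  · simp only [hM, true_and, if_true]
    rw [← Finset.sum_filter, ← Finset.mul_sum]
    congr 1
    have hset : (Finset.univ.erase x).powerset.filter (fun S => ∀ y ∈ S, e' y = e y)
        = ((Finset.univ.erase x).filter fun y => e' y = e y).powerset := by
      ext S
      simp only [Finset.mem_filter, Finset.mem_powerset, Finset.subset_iff]
      exact ⟨fun h y hy => ⟨h.1 hy, h.2 y hy⟩, fun h => ⟨fun y hy => (h hy).1, fun y hy => (h hy).2⟩⟩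
    rw [hset, Finset.sum_powerset_apply_card
      (fun j => (j.factorial : ℚ) * (n - 1 - j).factorial * 2 ^ j)]
    simp only [contribution, agreement]
    push_cast
    refine Finset.sum_congr rfl fun j _ => ?_
    -- The number of subsets of size `j` and the factor `j!` of the Shapley weight combine to a
    -- falling factorial.
    rw [Nat.descFactorial_eq_factorial_mul_choose]
    push_cast
    simp only [nsmul_eq_mul]
    ring
  · simp [hM]

/-! ### Counting accepted entities by their agreement. -/

/-- The number of accepted entities with agreement `k` that agree with `e` on `x`, or do not,
according to `v`. -/
def acceptedCount (M : (Fin n → Bool) → Bool) (e : Fin n → Bool) (x : Fin n) (v : Bool) (k : ℕ) :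
    ℕ :=
  (Finset.univ.filter fun e' => M e' = true ∧ decide (e' x = e x) = v ∧ agreement e x e' = k).card

/-- The inequality must be strict for the count to be a digit in base `2 ^ n`. It is, because the
entities with the other value at `x` are not counted. -/
theorem acceptedCount_lt (M : (Fin n → Bool) → Bool) (e : Fin n → Bool) (x : Fin n) (v : Bool)
    (k : ℕ) : acceptedCount M e x v k < 2 ^ n := by
  have h : (Finset.univ : Finset (Fin n → Bool)).card = 2 ^ n := by simp
  rw [← h]
  refine Finset.card_lt_card (Finset.ssubset_univ_iff.mpr fun h => ?_)
  have := h ▸ Finset.mem_univ (Function.update e x (e x ^^ v))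
  cases v <;> simp at this

/-- The values lie in a general monoid because the lemma serves twice: for rational contributions
and for natural powers of `B`. -/
theorem sum_accepted {R : Type*} [AddCommMonoid R] (M : (Fin n → Bool) → Bool) (e : Fin n → Bool)
    (x : Fin n) (G : Bool → ℕ → R) :
    ∑ e', (if M e' = true then G (decide (e' x = e x)) (agreement e x e') else 0)
      = ∑ k ∈ Finset.range n, acceptedCount M e x false k • G false k
        + ∑ k ∈ Finset.range n, acceptedCount M e x true k • G true k := by
  have h : ∀ e', (if M e' = true then G (decide (e' x = e x)) (agreement e x e') else 0)
      = ∑ k ∈ Finset.range n, ∑ v : Bool,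
        if M e' = true ∧ decide (e' x = e x) = v ∧ agreement e x e' = k then G v k else 0 := by
    intro e'
    by_cases hM : M e' = true
    · rw [Finset.sum_eq_single_of_mem (agreement e x e') (Finset.mem_range.mpr (agreement_lt e x e'))]
      · rw [Finset.sum_eq_single_of_mem (decide (e' x = e x)) (Finset.mem_univ _)]
        · simp [hM]
        · intro v _ hv
          simp [hv.symm]
      · intro k _ hk
        simp [hk.symm]
    · simp [hM]
  simp_rw [h]
  rw [Finset.sum_comm, ← Finset.sum_add_distrib]
  refine Finset.sum_congr rfl fun k _ => ?_
  rw [Finset.sum_comm, Fintype.sum_bool, add_comm]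
  simp only [← Finset.sum_filter, Finset.sum_const]
  rfl

theorem shap_eq_counts (M : (Fin n → Bool) → Bool) (e : Fin n → Bool) (x : Fin n) :
    shap M e x * (n.factorial * 2 ^ n) =
      ((∑ k ∈ Finset.range n, acceptedCount M e x true k * contribution n k : ℕ) : ℚ)
        - (∑ k ∈ Finset.range n, acceptedCount M e x false k * contribution n k : ℕ) := by
  have h := sum_accepted M e x fun v k => (if v = true then (1 : ℚ) else -1) * contribution n k
  simp only [decide_eq_true_eq] at h
  rw [shap_eq, h]
  push_cast
  simp [Finset.sum_neg_distrib]
  ring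

/-- The weights that mark agreement with `e`: by the factor `Z` on `x`, and by the factor `B` on
each of the other features. -/
def agreeWeight (e : Fin n → Bool) (x : Fin n) (B Z : ℕ) (v : Bool) (y : Fin n) : ℕ :=
  if e y = v then (if y = x then Z else B) else 1

theorem weight_agreeWeight (e : Fin n → Bool) (x : Fin n) (B Z : ℕ) (e' : Fin n → Bool) :
    weight (agreeWeight e x B Z true) (agreeWeight e x B Z false) e'
      = (if e' x = e x then Z else 1) * B ^ agreement e x e' := by
  have h : ∀ y, (if e' y = true then agreeWeight e x B Z true y else agreeWeight e x B Z false y)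
      = if e' y = e y then (if y = x then Z else B) else 1 := by
    intro y
    unfold agreeWeight
    cases e' y <;> cases e y <;> simp
  unfold weight
  simp_rw [h]
  rw [← Finset.mul_prod_erase _ _ (Finset.mem_univ x), agreement, ← Finset.prod_const,
    Finset.prod_filter, if_pos rfl]
  congr 1
  exact Finset.prod_congr rfl fun y hy => by rw [if_neg (Finset.ne_of_mem_erase hy)]

/-- With `Z = B ^ n` the counts of entities that disagree on `x` are the lower `n` digits, and those
of entities that agree on `x` are the upper `n`. -/
theorem wmc_agreeWeight (M : (Fin n → Bool) → Bool) (e : Fin n → Bool) (x : Fin n) (B Z : ℕ) :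
    wmc (agreeWeight e x B Z true) (agreeWeight e x B Z false) M
      = ∑ k ∈ Finset.range n, acceptedCount M e x false k * B ^ k
        + Z * ∑ k ∈ Finset.range n, acceptedCount M e x true k * B ^ k := by
  have h := sum_accepted M e x fun v k => (if v = true then Z else 1) * B ^ k
  simp only [decide_eq_true_eq] at h
  unfold wmc
  simp_rw [weight_agreeWeight]
  rw [h, Finset.mul_sum]
  congr 1
  · simp
  · exact Finset.sum_congr rfl fun k _ => by simp; ring

end Formula

/-! ### Digits in a base. -/

theorem digit_eq {B : ℕ} (j : ℕ) : ∀ {N R : ℕ} {c : ℕ → ℕ}, (∀ k < N, c k < B) → j < N →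
    (∑ k ∈ Finset.range N, c k * B ^ k + B ^ N * R) / B ^ j % B = c j := by
  -- Splitting off the lowest digit leaves an expression of the same shape with shifted digits, so
  -- the induction on `j` must generalise `c` and `N`.
  have key : ∀ (N R : ℕ) (c : ℕ → ℕ),
      ∑ k ∈ Finset.range (N + 1), c k * B ^ k + B ^ (N + 1) * R
        = c 0 + B * (∑ k ∈ Finset.range N, c (k + 1) * B ^ k + B ^ N * R) := fun N R c => by
    rw [Finset.sum_range_succ', mul_add, Finset.mul_sum]
    simp only [pow_succ, pow_zero, mul_one]
    rw [Finset.sum_congr rfl fun k _ => show c (k + 1) * (B ^ k * B) = B * (c (k + 1) * B ^ k) by ring]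
    ring
  induction j with
  | zero =>
    intro N R c hc hj
    obtain ⟨N, rfl⟩ : ∃ N', N = N' + 1 := ⟨N - 1, by omega⟩
    rw [key, pow_zero, Nat.div_one, Nat.add_mul_mod_self_left, Nat.mod_eq_of_lt (hc 0 hj)]
  | succ j ih =>
    intro N R c hc hj
    obtain ⟨N, rfl⟩ : ∃ N', N = N' + 1 := ⟨N - 1, by omega⟩
    have h0 := hc 0 (by omega)
    rw [key, pow_succ', ← Nat.div_div_eq_div_mul, Nat.add_mul_div_left _ _ (by omega),
      Nat.div_eq_of_lt h0, zero_add]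
    exact ih (fun k hk => hc (k + 1) (by omega)) (by omega)

theorem sum_digits_lt {B : ℕ} : ∀ {N : ℕ} {c : ℕ → ℕ}, (∀ k < N, c k < B) →
    ∑ k ∈ Finset.range N, c k * B ^ k < B ^ N := by
  intro N c hc
  induction N with
  | zero => simp
  | succ N ih =>
    rw [Finset.sum_range_succ, pow_succ']
    have h1 := ih fun k hk => hc k (by omega)
    have h2 := Nat.mul_le_mul_right (B ^ N) (Nat.succ_le_of_lt (hc N (by omega)))
    rw [Nat.succ_mul] at h2
    omega

/-! ### The common part of the programs -/

namespace Expr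

instance (v : ℕ) : OfNat Expr v := ⟨lit v⟩
instance : Add Expr := ⟨bin .add⟩
instance : Sub Expr := ⟨bin .sub⟩
instance : Mul Expr := ⟨bin .mul⟩
instance : Div Expr := ⟨bin .div⟩

section

variable (M : ℕ) (s : State) (e₁ e₂ : Expr)

@[simp] theorem eval_ofNat (v : ℕ) : eval s ofNat(v) = v := rfl
@[simp] theorem eval_var (r : ℕ) : eval s (var r) = s.reg r := rfl
@[simp] theorem eval_get (a : ℕ) : eval s (get a e₁) = s.arr a (e₁.eval s) := rfl
@[simp] theorem eval_add : eval s (e₁ + e₂) = e₁.eval s + e₂.eval s := rfl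
@[simp] theorem eval_sub : eval s (e₁ - e₂) = e₁.eval s - e₂.eval s := rfl
@[simp] theorem eval_mul : eval s (e₁ * e₂) = e₁.eval s * e₂.eval s := rfl
@[simp] theorem eval_div : eval s (e₁ / e₂) = e₁.eval s / e₂.eval s := rfl
@[simp] theorem fits_ofNat (v : ℕ) : Fits M s ofNat(v) ↔ v < 2 ^ M := Iff.rfl
@[simp] theorem fits_var (r : ℕ) : Fits M s (var r) ↔ True := Iff.rfl
@[simp] theorem fits_get (a : ℕ) : Fits M s (get a e₁) ↔ e₁.Fits M s := Iff.rfl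
@[simp] theorem fits_add : Fits M s (e₁ + e₂) ↔
    e₁.Fits M s ∧ e₂.Fits M s ∧ e₁.eval s + e₂.eval s < 2 ^ M := Iff.rfl
@[simp] theorem fits_mul : Fits M s (e₁ * e₂) ↔
    e₁.Fits M s ∧ e₂.Fits M s ∧ e₁.eval s * e₂.eval s < 2 ^ M := Iff.rfl
@[simp] theorem fits_sub : Fits M s (e₁ - e₂) ↔ e₁.Fits M s ∧ e₂.Fits M s := Iff.rfl
@[simp] theorem fits_div : Fits M s (e₁ / e₂) ↔ e₁.Fits M s ∧ e₂.Fits M s := Iff.rfl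

end

end Expr

namespace State

@[simp] theorem setReg_reg (s : State) (r v r' : ℕ) :
    (s.setReg r v).reg r' = if r' = r then v else s.reg r' := by
  simp [setReg, Function.update_apply]

@[simp] theorem setReg_arr (s : State) (r v : ℕ) : (s.setReg r v).arr = s.arr := rfl

@[simp] theorem setArr_reg (s : State) (a i v : ℕ) : (s.setArr a i v).reg = s.reg := rfl

@[simp] theorem setArr_arr (s : State) (a i v a' : ℕ) : (s.setArr a i v).arr a'
    = if a' = a then Function.update (s.arr a) i v else s.arr a' := by
  by_cases h : a' = a
  · subst h; simp [setArr]
  · simp [setArr, h]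

end State

open ShapScore.Expr in
/-- Compute `n`, `B = 2 ^ n`, `Z = B ^ n`, `n!`, the weights (arrays `1` and `2`) and their total
`T` in the registers `3`, `4`, `6`, `7` and `8`. -/
def setup : Cmd :=
  .seq (.set 3 (get 0 0)) <|
  .seq (.set 4 1) <|
  .seq (.rep 5 (var 3) (.set 4 (var 4 + var 4))) <|
  .seq (.set 6 1) <|
  .seq (.set 7 1) <|
  .seq (.rep 5 (var 3) (
    -- Conditionals in arithmetical form: with a bit `t`, `1 + t * (B - 1)` is `B` or `1`, and `B -
    -- t * (B - 1)` is the other of the two.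
    .seq (.put 1 (var 5) (1 + get 0 (2 + var 5) * (var 4 - 1))) <|
    .seq (.put 2 (var 5) (var 4 - get 0 (2 + var 5) * (var 4 - 1))) <|
    .seq (.set 6 (var 6 * var 4)) <|
    .set 7 (var 7 * (var 5 + 1)))) <|
  -- Cell `1` of the input is the feature `x`, whose weight `B` is now replaced by `Z`.
  .seq (.put 1 (get 0 1) (1 + get 0 (2 + get 0 1) * (var 6 - 1))) <|
  .seq (.put 2 (get 0 1) (var 6 - get 0 (2 + get 0 1) * (var 6 - 1))) <|
  .seq (.set 8 1) <|
  .rep 5 (var 3) (.set 8 (var 8 * (get 1 (var 5) + get 2 (var 5))))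

open ShapScore.Expr in
/-- With the weighted count of the classifier in register `16`, compute its digits with respect to
the base `B` and combine them with the contributions. -/
def finish : Cmd :=
  .seq (.set 17 (var 16 / var 6)) <|
  .seq (.set 18 (var 7 / var 3)) <|
  .seq (.set 19 0) <|
  .seq (.set 20 0) <|
  .seq (.rep 21 (var 3) (
    -- `X - B * (X / B)` is the lowest digit of `X`.
    .seq (.set 19 (var 19 + (var 17 - var 4 * (var 17 / var 4)) * var 18)) <|
    .seq (.set 20 (var 20 + (var 16 - var 4 * (var 16 / var 4)) * var 18)) <|
    .seq (.set 17 (var 17 / var 4)) <|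
    .seq (.set 16 (var 16 / var 4)) <|
    -- The recurrence `contribution_succ`. In the last pass the divisor is `0`, and the result is
    -- not used any more.
    .set 18 ((var 7 + (var 21 + 1) * var 18) / (var 3 - 1 - var 21)))) <|
  -- The sign: a positive truncated difference divided by itself is `1`, while `0 / 0 = 0`. The next
  -- line adds both truncated differences to get the absolute value.
  .seq (.set 0 ((var 20 - var 19) / (var 20 - var 19))) <|
  .seq (.set 2 ((var 19 - var 20) + (var 20 - var 19))) <|
  .set 1 (var 7 * var 4)

open ShapScore.Expr in
/-- The number of nodes is put into register `9`; then they are evaluated in as many rounds, each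
of which runs `body` for all nodes (register `11`). The array `3` holds their values. -/
def shapProgram (body : Cmd) : Cmd :=
  .seq setup <|
  -- Cells `0` to `n + 1` hold `n`, `x` and the entity; the number of nodes and the output node
  -- follow in cells `n + 2` and `n + 3`.
  .seq (.set 9 (get 0 (var 3 + 2))) <|
  .seq (.rep 10 (var 9) (.rep 11 (var 9) body)) <|
  .seq (.set 16 (get 3 (get 0 (var 3 + 3)))) <|
  finish

/-- The values of a function on `Fin n` in an array. -/
def toArray {n : ℕ} (a : Fin n → ℕ) (i : ℕ) : ℕ := if h : i < n then a ⟨i, h⟩ else 0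

theorem toArray_of_lt {n : ℕ} (a : Fin n → ℕ) {i : ℕ} (h : i < n) : toArray a i = a ⟨i, h⟩ := by
  simp [toArray, h]

@[simp] theorem toArray_val {n : ℕ} (a : Fin n → ℕ) (i : Fin n) : toArray a i = a i := by
  simp [toArray]

/-- What `setup` computes and the evaluation of the nodes does not change. -/
structure Frame {n : ℕ} (I : ℕ → ℕ) (a b : Fin n → ℕ) (s : State) : Prop where
  reg_three : s.reg 3 = n
  reg_four : s.reg 4 = 2 ^ n
  reg_six : s.reg 6 = (2 ^ n) ^ n
  reg_seven : s.reg 7 = n.factorial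
  reg_eight : s.reg 8 = totalWeight a b
  arr_zero : s.arr 0 = I
  arr_one : s.arr 1 = toArray a
  arr_two : s.arr 2 = toArray b

theorem Frame.setReg {n : ℕ} {I : ℕ → ℕ} {a b : Fin n → ℕ} {s : State} (h : Frame I a b s)
    {r : ℕ} (v : ℕ) (hr : r ∉ ({3, 4, 6, 7, 8} : Finset ℕ)) : Frame I a b (s.setReg r v) := by
  simp only [Finset.mem_insert, Finset.mem_singleton, not_or] at hr
  obtain ⟨h1, h2, h3, h4, h5, h6, h7, h8⟩ := h
  constructor <;> simp [*, Ne.symm hr.1, Ne.symm hr.2.1, Ne.symm hr.2.2.1, Ne.symm hr.2.2.2.1,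
    Ne.symm hr.2.2.2.2]

theorem Frame.setArr {n : ℕ} {I : ℕ → ℕ} {a b : Fin n → ℕ} {s : State} (h : Frame I a b s)
    {r : ℕ} (i v : ℕ) (hr : 3 ≤ r) : Frame I a b (s.setArr r i v) := by
  obtain ⟨h1, h2, h3, h4, h5, h6, h7, h8⟩ := h
  constructor <;> simp [*, show (0 : ℕ) ≠ r by omega, show (1 : ℕ) ≠ r by omega,
    show (2 : ℕ) ≠ r by omega]

/-- Bounds for the numbers in a computation with inputs of length `L`: the basic quantities are at
most `W`, and all numbers are less than `2 ^ M`. -/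
structure Bounds (M L W : ℕ) : Prop where
  -- The exponent is large enough for contributions, at most `2 ^ (2 * n + 2 * n * n)`, and for the
  -- total weight, at most `2 ^ ((n * n + 1) * n)`.
  le : 2 ^ (4 * L ^ 3 + 4) ≤ W
  -- Products of two numbers up to `W ^ 2` reach `W ^ 4`; the additional factor makes the inequality
  -- strict.
  pow_le : W ^ 5 ≤ 2 ^ M

theorem le_sq_of_le {W x : ℕ} (hx : x ≤ W) : x ≤ W ^ 2 := hx.trans (Nat.le_self_pow (by omega) W)

theorem mul_le_sq {W x y : ℕ} (hx : x ≤ W) (hy : y ≤ W) : x * y ≤ W ^ 2 :=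
  (Nat.mul_le_mul hx hy).trans (by rw [sq])

namespace Bounds

variable {M L W : ℕ}

theorem sixteen_le (hB : Bounds M L W) : 16 ≤ W :=
  (show 16 = 2 ^ 4 by norm_num) ▸ (Nat.pow_le_pow_right (by omega) (by omega)).trans hB.le

theorem two_pow_le (hB : Bounds M L W) {k : ℕ} (hk : k ≤ 4 * L ^ 3 + 4) : 2 ^ k ≤ W :=
  (Nat.pow_le_pow_right (by omega) hk).trans hB.le

theorem lt_of_le (hB : Bounds M L W) {x : ℕ} (hx : x ≤ W ^ 4) : x < 2 ^ M := by
  have h := hB.sixteen_le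
  have h1 : 0 < W ^ 4 := Nat.pow_pos (by omega)
  have h2 := hB.pow_le
  have h3 : W ^ 4 * 16 ≤ W ^ 4 * W := Nat.mul_le_mul_left _ h
  rw [pow_succ] at h2
  omega

theorem mul_lt (hB : Bounds M L W) {x y : ℕ} (hx : x ≤ W ^ 2) (hy : y ≤ W ^ 2) : x * y < 2 ^ M :=
  hB.lt_of_le ((Nat.mul_le_mul hx hy).trans (by rw [← pow_add]))

theorem two_mul_sq_le (hB : Bounds M L W) : 2 * W ^ 2 ≤ W ^ 4 := by
  have h := hB.sixteen_le
  have : 16 * 16 ≤ W ^ 2 := by rw [sq]; exact Nat.mul_le_mul h h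
  calc 2 * W ^ 2 ≤ W ^ 2 * W ^ 2 := Nat.mul_le_mul_right _ (by omega)
    _ = W ^ 4 := by rw [← pow_add]

theorem add_lt (hB : Bounds M L W) {x y : ℕ} (hx : x ≤ W ^ 2) (hy : y ≤ W ^ 2) : x + y < 2 ^ M :=
  hB.lt_of_le (by have := hB.two_mul_sq_le; omega)

theorem lt (hB : Bounds M L W) {x : ℕ} (hx : x ≤ W ^ 2) : x < 2 ^ M := by
  have := hB.add_lt hx (Nat.zero_le _); omega

theorem small_lt (hB : Bounds M L W) {x : ℕ} (hx : x ≤ 16) : x < 2 ^ M :=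
  hB.lt (le_sq_of_le (hx.trans hB.sixteen_le))

theorem le_of_le (hB : Bounds M L W) {k : ℕ} (hk : k ≤ L) : k ≤ W := by
  refine Nat.lt_two_pow_self.le.trans (hB.two_pow_le ?_)
  have := Nat.le_self_pow (show 3 ≠ 0 by omega) L
  omega

end Bounds

theorem agreeWeight_eq {n : ℕ} (e : Fin n → Bool) (x : Fin n) {B Z : ℕ} (hB : 0 < B) (hZ : 0 < Z)
    (y : Fin n) :
    agreeWeight e x B Z true y = 1 + (e y).toNat * ((if y = x then Z else B) - 1) ∧
    agreeWeight e x B Z false y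
      = (if y = x then Z else B) - (e y).toNat * ((if y = x then Z else B) - 1) := by
  unfold agreeWeight
  have : 0 < if y = x then Z else B := by split <;> assumption
  cases e y
  · simp
  · simp; omega

theorem agreeWeight_add {n : ℕ} (e : Fin n → Bool) (x : Fin n) (B Z : ℕ) (y : Fin n) :
    agreeWeight e x B Z true y + agreeWeight e x B Z false y = 1 + if y = x then Z else B := by
  unfold agreeWeight
  cases e y <;> simp [add_comm]

/-! ### Sizes of the basic quantities. -/

section Magnitudes

variable {M L W n : ℕ}

theorem sq_le_cube (hn : n ≤ L) : n * n ≤ L ^ 3 := by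
  rcases Nat.eq_zero_or_pos L with h | h
  · subst h; simp [Nat.le_zero.mp hn]
  · calc n * n ≤ L * L := Nat.mul_le_mul hn hn
      _ ≤ L * L * L := Nat.le_mul_of_pos_right _ h
      _ = L ^ 3 := by ring

theorem le_cube (hn : n ≤ L) : n ≤ L ^ 3 := hn.trans (Nat.le_self_pow (by omega) L)

theorem base_le (hB : Bounds M L W) (hn : n ≤ L) : 2 ^ n ≤ W :=
  hB.two_pow_le (by have := le_cube hn; omega)

theorem base_pow_le (hB : Bounds M L W) (hn : n ≤ L) {j : ℕ} (hj : j ≤ n) : (2 ^ n) ^ j ≤ W := by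
  rw [← pow_mul]
  exact hB.two_pow_le (by have := sq_le_cube hn; have := Nat.mul_le_mul_left n hj; omega)

theorem factorial_le (hB : Bounds M L W) (hn : n ≤ L) : n.factorial ≤ W :=
  (Nat.factorial_le_pow n).trans ((Nat.pow_le_pow_left Nat.lt_two_pow_self.le n).trans
    (base_pow_le hB hn le_rfl))

/-- Each factor is at most `2 ^ (n * n) + 1`. General subsets are admitted to cover single factors
and the partial products in `setup`. -/
theorem prod_agreeWeight_le (hB : Bounds M L W) (hn : n ≤ L) (e : Fin n → Bool) (x : Fin n)
    (s : Finset (Fin n)) :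
    ∏ y ∈ s, (agreeWeight e x (2 ^ n) ((2 ^ n) ^ n) true y
      + agreeWeight e x (2 ^ n) ((2 ^ n) ^ n) false y) ≤ W := by
  have hx := x.pos
  have h : ∀ y ∈ s, agreeWeight e x (2 ^ n) ((2 ^ n) ^ n) true y
      + agreeWeight e x (2 ^ n) ((2 ^ n) ^ n) false y ≤ 2 ^ (n * n + 1) := by
    intro y _
    rw [agreeWeight_add, ← pow_mul, pow_succ]
    have h1 : 2 ^ n ≤ 2 ^ (n * n) := Nat.pow_le_pow_right (by omega) (Nat.le_mul_of_pos_left n hx)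
    have h2 : 1 ≤ 2 ^ n := Nat.one_le_two_pow
    split <;> omega
  refine (Finset.prod_le_pow_card _ _ _ h).trans ?_
  rw [← pow_mul]
  refine hB.two_pow_le ?_
  have h1 : s.card ≤ L := (s.card_le_univ.trans (by simp)).trans hn
  have h2 : (n * n + 1) * s.card ≤ (L * L + 1) * L :=
    Nat.mul_le_mul (Nat.add_le_add_right (Nat.mul_le_mul hn hn) 1) h1
  have h3 : (L * L + 1) * L = L ^ 3 + L := by ring
  have := le_cube (le_refl L)
  omega

theorem contribution_le_bound (hB : Bounds M L W) (hn : n ≤ L) {k : ℕ} (hk : k < n) :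
    contribution n k ≤ W := by
  have h : n ≤ 2 ^ n := Nat.lt_two_pow_self.le
  refine (contribution_le hk).trans ?_
  calc n * (n ^ n * n ^ n * 2 ^ n) ≤ 2 ^ n * ((2 ^ n) ^ n * (2 ^ n) ^ n * 2 ^ n) := by gcongr
    _ = 2 ^ (n + n + n * n + n * n) := by simp only [← pow_mul, ← pow_add]; congr 1; ring
    _ ≤ W := hB.two_pow_le (by have := le_cube hn; have := sq_le_cube hn; omega)

end Magnitudes

/-- The first numbers of the input: the number of features, the feature, and the entity. -/
structure Header {n : ℕ} (e : Fin n → Bool) (x : Fin n) (I : ℕ → ℕ) : Prop where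
  zero : I 0 = n
  one : I 1 = x
  entity : ∀ y : Fin n, I (2 + y) = (e y).toNat

theorem update_partial {n j : ℕ} (a : Fin n → ℕ) (hj : j < n) :
    Function.update (fun i => if i < j then toArray a i else 0) j (a ⟨j, hj⟩)
      = fun i => if i < j + 1 then toArray a i else 0 := by
  funext i
  by_cases h : i = j
  · subst h; simp [toArray_of_lt a hj]
  · have : i < j + 1 ↔ i < j := by omega
    simp [h, this]

theorem toArray_partial {n : ℕ} (a : Fin n → ℕ) :
    (fun i => if i < n then toArray a i else 0) = toArray a := by
  funext i
  by_cases h : i < n <;> simp [toArray, h]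

theorem update_toArray {n : ℕ} (a : Fin n → ℕ) (x : Fin n) (v : ℕ) :
    Function.update (toArray a) x v = toArray (Function.update a x v) := by
  funext i
  by_cases h : i = x
  · subst h; simp
  · by_cases h' : i < n
    · have : (⟨i, h'⟩ : Fin n) ≠ x := fun e => h (by rw [← e])
      simp [h, toArray_of_lt _ h', this]
    · simp [h, toArray, h']

/-- The loop in `setup` treats `x` like every other feature; this accounts for the correction at `x`
afterwards. -/
theorem update_agreeWeight {n : ℕ} (e : Fin n → Bool) (x : Fin n) (B Z : ℕ) (v : Bool) :
    Function.update (agreeWeight e x B B v) x (agreeWeight e x B Z v x)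
      = agreeWeight e x B Z v := by
  funext y
  by_cases h : y = x
  · subst h; simp
  · simp [h, agreeWeight]

theorem setup_ok {M L W n : ℕ} (hB : Bounds M L W) (hn : n ≤ L) {e : Fin n → Bool} {x : Fin n}
    {I : ℕ → ℕ} (hI : Header e x I) {s : State} (h0 : s.arr 0 = I) (h1 : s.arr 1 = fun _ => 0)
    (h2 : s.arr 2 = fun _ => 0) (h3 : s.arr 3 = fun _ => 0) :
    setup.Ok M L s fun s' => Frame I (agreeWeight e x (2 ^ n) ((2 ^ n) ^ n) true)
      (agreeWeight e x (2 ^ n) ((2 ^ n) ^ n) false) s' ∧ s'.arr 3 = fun _ => 0 := by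
  have hBpos : 0 < 2 ^ n := Nat.two_pow_pos n
  have hZpos : 0 < (2 ^ n) ^ n := Nat.pow_pos hBpos
  have hnW := hB.le_of_le hn
  have hbit : ∀ y : Fin n, I (2 + y) ≤ 1 := fun y => by
    rw [hI.entity]; cases e y <;> simp
  have hbW : ∀ y : Fin n, ∀ z ≤ W, I (2 + y) * (z - 1) ≤ W := fun y z hz =>
    (Nat.mul_le_mul (hbit y) (Nat.sub_le z 1)).trans (by omega)
  have one_le : 1 ≤ W ^ 2 := Nat.one_le_pow _ _ (by have := hB.sixteen_le; omega)
  have hc : ∀ k, k ≤ 16 → k < 2 ^ M := fun k hk => hB.small_lt hk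
  refine .seq (.set ?_ ?_)
  · simp [hc]
  refine .seq (.set ?_ ?_)
  · exact hc 1 (by omega)
  refine .seq (.rep n (fun j s => s.reg 3 = n ∧ s.reg 4 = 2 ^ j ∧ s.arr 0 = I ∧
    (s.arr 1 = fun _ => 0) ∧ (s.arr 2 = fun _ => 0) ∧ (s.arr 3 = fun _ => 0)) ?_ ?_ hn ?_ ?_ ?_)
  · simp
  · simp [h0, hI.zero]
  · simp [h0, h1, h2, h3, hI.zero]
  · rintro j hj s ⟨r3, r4, a0, a1, a2, a3⟩
    have hj' : 2 ^ j ≤ W ^ 2 := le_sq_of_le (base_le hB (by omega))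
    refine .set ?_ ?_
    · simpa [r4] using hB.add_lt hj' hj'
    · simp [r3, r4, a0, a1, a2, a3, pow_succ, mul_two]
  rintro s ⟨r3, r4, a0, a1, a2, a3⟩
  refine .seq (.set (hc 1 (by omega)) (.seq (.set (hc 1 (by omega)) ?_)))
  refine .seq (.rep n (fun j s => s.reg 3 = n ∧ s.reg 4 = 2 ^ n ∧ s.reg 6 = (2 ^ n) ^ j ∧
    s.reg 7 = j.factorial ∧ s.arr 0 = I ∧
    (s.arr 1 = fun i => if i < j then toArray (agreeWeight e x (2 ^ n) (2 ^ n) true) i else 0) ∧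
    (s.arr 2 = fun i => if i < j then toArray (agreeWeight e x (2 ^ n) (2 ^ n) false) i else 0) ∧
    (s.arr 3 = fun _ => 0)) ?_ ?_ hn ?_ ?_ ?_)
  · simp
  · simp [r3]
  · simp [r3, r4, a0, a1, a2, a3]
  · rintro j hj s ⟨r3, r4, r6, r7, a0, a1, a2, a3⟩
    have hw := agreeWeight_eq e x hBpos hBpos ⟨j, hj⟩
    rw [← hI.entity, ite_self] at hw
    have hbj := hbW ⟨j, hj⟩ (2 ^ n) (base_le hB hn)
    have hbj' : I (2 + j) * (2 ^ n - 1) < 2 ^ M := hB.lt (le_sq_of_le hbj)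
    have hadd : 2 + j < 2 ^ M := hB.add_lt (le_sq_of_le (by have := hB.sixteen_le; omega))
      (le_sq_of_le (by omega))
    refine .seq (.put ?_ ?_ (.seq (.put ?_ ?_ (.seq (.set ?_ (.set ?_ ?_))))))
    · simp
    · simpa [r4, a0, hc, hadd, hbj'] using hB.add_lt one_le (le_sq_of_le hbj)
    · simp
    · simp [r4, a0, hc, hadd, hbj']
    · simpa [r4, r6] using hB.mul_lt (le_sq_of_le (base_pow_le hB hn hj.le))
        (le_sq_of_le (base_le hB hn))
    · have h5 : j + 1 ≤ W ^ 2 := le_sq_of_le (by omega)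
      simpa [r7, hc, hB.lt h5] using hB.mul_lt
        (le_sq_of_le ((Nat.factorial_le hj.le).trans (factorial_le hB hn))) h5
    · simp [r3, r4, r6, r7, a0, a1, a2, a3, ← hw.1, ← hw.2, update_partial _ hj, pow_succ,
        Nat.factorial_succ, mul_comm]
  rintro s ⟨r3, r4, r6, r7, a0, a1, a2, a3⟩
  rw [toArray_partial] at a1 a2
  have hw := agreeWeight_eq e x hBpos hZpos x
  rw [← hI.entity, if_pos rfl] at hw
  have hbj := hbW x ((2 ^ n) ^ n) (base_pow_le hB hn le_rfl)
  have hbj' : I (2 + x) * ((2 ^ n) ^ n - 1) < 2 ^ M := hB.lt (le_sq_of_le hbj)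
  have hadd : 2 + (x : ℕ) < 2 ^ M := hB.add_lt (le_sq_of_le (by have := hB.sixteen_le; omega))
    (le_sq_of_le (by omega))
  refine .seq (.put ?_ ?_ (.seq (.put ?_ ?_ (.seq (.set (hc 1 (by omega)) ?_)))))
  · simp [hc]
  · simpa [r6, a0, hc, hadd, hbj', hI.one] using hB.add_lt one_le (le_sq_of_le hbj)
  · simp [hc]
  · simp [r6, a0, hc, hadd, hbj', hI.one]
  refine .rep n (fun j s => s.reg 3 = n ∧ s.reg 4 = 2 ^ n ∧ s.reg 6 = (2 ^ n) ^ n ∧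
    s.reg 7 = n.factorial ∧ s.reg 8 = ∏ y : Fin n with y.1 < j,
      (agreeWeight e x (2 ^ n) ((2 ^ n) ^ n) true y + agreeWeight e x (2 ^ n) ((2 ^ n) ^ n) false y) ∧
    s.arr 0 = I ∧ s.arr 1 = toArray (agreeWeight e x (2 ^ n) ((2 ^ n) ^ n) true) ∧
    s.arr 2 = toArray (agreeWeight e x (2 ^ n) ((2 ^ n) ^ n) false) ∧
    (s.arr 3 = fun _ => 0)) ?_ ?_ hn ?_ ?_ ?_
  · simp
  · simp [r3]
  · simp [r3, r4, r6, r7, a0, a1, a2, a3, hI.one, ← hw.1, ← hw.2, update_toArray,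
      update_agreeWeight]
  · rintro j hj s ⟨r3, r4, r6, r7, r8, a0, a1, a2, a3⟩
    have hs : (Finset.univ.filter fun y : Fin n => y.1 < j + 1)
        = insert ⟨j, hj⟩ (Finset.univ.filter fun y : Fin n => y.1 < j) := by
      ext y; simp [Fin.ext_iff]; omega
    have h5 := prod_agreeWeight_le hB hn e x {⟨j, hj⟩}
    rw [Finset.prod_singleton] at h5
    have h6 := prod_agreeWeight_le hB hn e x (Finset.univ.filter fun y : Fin n => y.1 < j)
    refine .set ?_ ?_
    · simpa [r8, a1, a2, toArray_of_lt _ hj, hB.lt (le_sq_of_le h5)] using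
        hB.mul_lt (le_sq_of_le h6) (le_sq_of_le h5)
    · rw [hs, Finset.prod_insert (by simp)]
      simp [r3, r4, r6, r7, r8, a0, a1, a2, a3, toArray_of_lt _ hj, mul_comm]
  · rintro s ⟨r3, r4, r6, r7, r8, a0, a1, a2, a3⟩
    refine ⟨⟨r3, r4, r6, r7, ?_, a0, a1, a2⟩, a3⟩
    simp [r8, totalWeight]
-- Division by `B ^ n` isolates the upper digits. Both halves are then read from the lowest digit
-- on, and each digit is multiplied by the contribution of its position.
theorem finish_ok {M L W n : ℕ} (hB : Bounds M L W) (hn : n ≤ L) (hn0 : 0 < n) {I : ℕ → ℕ}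
    {a b : Fin n → ℕ} {s : State} (hs : Frame I a b s) {c d : ℕ → ℕ} (hc : ∀ k, c k < 2 ^ n)
    (hd : ∀ k, d k < 2 ^ n)
    (h : s.reg 16 = ∑ k ∈ Finset.range n, c k * (2 ^ n) ^ k
      + (2 ^ n) ^ n * ∑ k ∈ Finset.range n, d k * (2 ^ n) ^ k) :
    finish.Ok M L s fun s' => s'.reg 1 = n.factorial * 2 ^ n ∧
      (-1 : ℚ) ^ s'.reg 0 * s'.reg 2 = (∑ k ∈ Finset.range n, d k * contribution n k : ℕ)
        - (∑ k ∈ Finset.range n, c k * contribution n k : ℕ) := by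
  set B := 2 ^ n with hBdef
  set Q := s.reg 16 with hQ
  set R := ∑ k ∈ Finset.range n, d k * B ^ k with hR
  have hZpos : 0 < B ^ n := Nat.pow_pos (Nat.two_pow_pos n)
  have hQR : Q / B ^ n = R := by
    rw [h, Nat.add_mul_div_left _ _ hZpos, Nat.div_eq_of_lt (sum_digits_lt fun k _ => hc k),
      zero_add]
  have dc : ∀ k < n, Q / B ^ k % B = c k := fun k hk => by
    rw [h]; exact digit_eq k (fun j _ => hc j) hk
  have dd : ∀ k < n, R / B ^ k % B = d k := fun k hk => by
    have := digit_eq (R := 0) k (fun j _ => hd j) hk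
    rwa [mul_zero, add_zero] at this
  have lit : ∀ k, k ≤ 16 → k < 2 ^ M := fun k hk => hB.small_lt hk
  have hBW : B ≤ W := base_le hB hn
  have hnW := hB.le_of_le hn
  have part : ∀ c : ℕ → ℕ, (∀ k, c k < B) → ∀ j ≤ n,
      ∑ k ∈ Finset.range j, c k * contribution n k ≤ W ^ 3 := by
    intro c hc j hj
    refine (Finset.sum_le_card_nsmul _ _ (W * W) fun k hk => Nat.mul_le_mul
      ((hc k).le.trans hBW) (contribution_le_bound hB hn ?_)).trans ?_
    · have := Finset.mem_range.mp hk; omega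
    · rw [Finset.card_range, smul_eq_mul]
      exact (Nat.mul_le_mul_right _ (show j ≤ W by omega)).trans_eq (by ring)
  refine .seq (.set (by simp) (.seq (.set (by simp) (.seq (.set (lit 0 (by omega))
    (.seq (.set (lit 0 (by omega)) (.seq
      (.rep n (fun j s => Frame I a b s ∧
      -- Nothing is claimed about register `18` after the last pass, which divides by zero.
      s.reg 16 = Q / B ^ j ∧ s.reg 17 = R / B ^ j ∧ (j < n → s.reg 18 = contribution n j) ∧
      s.reg 19 = ∑ k ∈ Finset.range j, d k * contribution n k ∧
      s.reg 20 = ∑ k ∈ Finset.range j, c k * contribution n k) ?_ ?_ hn ?_ ?_ ?_)))))))))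
  · simp
  · simp [hs.reg_three]
  · refine ⟨((((hs.setReg _ (by decide)).setReg _ (by decide)).setReg _ (by decide)).setReg _
      (by decide)), ?_⟩
    have : n.factorial / n = (n - 1).factorial := by
      rw [← Nat.mul_factorial_pred hn0.ne', Nat.mul_div_cancel_left _ hn0]
    simp [hs.reg_six, hs.reg_seven, hs.reg_three, ← hBdef, hQR, ← hQ, contribution_zero, this]
  · rintro j hj s ⟨hs, r16, r17, r18, r19, r20⟩
    have r18 := r18 hj
    have hV := contribution_le_bound hB hn hj
    have m1 : ∀ X : ℕ, X - B * (X / B) = X % B := fun X => (Nat.mod_eq_sub_mul_div).symm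
    have m2 : ∀ X ≤ W ^ 2, B * (X / B) < 2 ^ M := fun X hX => hB.lt ((Nat.mul_div_le X B).trans hX)
    have hRW : R ≤ W := (sum_digits_lt fun k _ => hd k).le.trans (base_pow_le hB hn le_rfl)
    have hQW : Q ≤ W ^ 2 := by
      have h1 : ∑ k ∈ Finset.range n, c k * B ^ k < B ^ n := sum_digits_lt fun k _ => hc k
      have h2 : R < B ^ n := sum_digits_lt fun k _ => hd k
      have h3 := Nat.mul_le_mul_left (B ^ n) (Nat.succ_le_of_lt h2)
      have h4 : B ^ n * B ^ n ≤ W ^ 2 := mul_le_sq (base_pow_le hB hn le_rfl) (base_pow_le hB hn le_rfl)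
      rw [Nat.mul_succ] at h3
      omega
    have m3 : R / B ^ j ≤ W ^ 2 := (Nat.div_le_self _ _).trans (le_sq_of_le hRW)
    have m4 : Q / B ^ j ≤ W ^ 2 := (Nat.div_le_self _ _).trans hQW
    have digit_mul : ∀ c : ℕ → ℕ, (∀ k, c k < B) → c j * contribution n j < 2 ^ M := fun c hc =>
      hB.lt (mul_le_sq ((hc j).le.trans hBW) hV)
    have digit_add : ∀ c : ℕ → ℕ, (∀ k, c k < B) →
        ∑ k ∈ Finset.range j, c k * contribution n k + c j * contribution n j < 2 ^ M := by
      intro c hc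
      rw [← Finset.sum_range_succ]
      exact hB.lt_of_le ((part c hc (j + 1) hj).trans
        (Nat.pow_le_pow_right (by have := hB.sixteen_le; omega) (by omega)))
    have hjV : (j + 1) * contribution n j ≤ W ^ 2 := mul_le_sq (by omega) hV
    refine .seq (.set ?_ (.seq (.set ?_ (.seq (.set ?_ (.seq (.set ?_ (.set ?_ ?_))))))))
    · simp [hs.reg_four, r17, r18, r19, ← hBdef, m1, m2 _ m3, dd j hj, digit_mul d hd,
        digit_add d hd]
    · simp [hs.reg_four, r16, r18, r20, ← hBdef, m1, m2 _ m4, dc j hj, digit_mul c hc,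
        digit_add c hc]
    · simp
    · simp
    · have h1 : j + 1 < 2 ^ M := hB.lt (le_sq_of_le (by omega))
      simp [hs.reg_seven, r18, lit 1 (by omega), h1, hB.lt hjV,
        hB.add_lt (le_sq_of_le (factorial_le hB hn)) hjV]
    · refine ⟨(((((hs.setReg _ (by decide)).setReg _ (by decide)).setReg _ (by decide)).setReg _
        (by decide)).setReg _ (by decide)).setReg _ (by decide), ?_, ?_, fun h => ?_, ?_, ?_⟩
      · simp [hs.reg_four, r16, pow_succ, Nat.div_div_eq_div_mul, ← hBdef]
      · simp [hs.reg_four, r17, pow_succ, Nat.div_div_eq_div_mul, ← hBdef]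
      · simp only [Expr.eval_div, Expr.eval_add, Expr.eval_mul, Expr.eval_sub, Expr.eval_var,
          Expr.eval_ofNat, State.setReg_reg]
        simp only [hs.reg_seven, hs.reg_three, r18, Nat.reduceEqDiff, if_true, if_false]
        rw [← contribution_succ h]
        exact Nat.mul_div_cancel _ (by omega)
      · simp [hs.reg_four, r17, r18, r19, ← hBdef, m1, dd j hj, Finset.sum_range_succ]
      · simp [hs.reg_four, r16, r18, r20, ← hBdef, m1, dc j hj, Finset.sum_range_succ]
  · rintro s ⟨hs, -, -, -, r19, r20⟩
    have hp := part d hd n le_rfl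
    have hn := part c hc n le_rfl
    set p := ∑ k ∈ Finset.range n, d k * contribution n k
    set q := ∑ k ∈ Finset.range n, c k * contribution n k
    have hpq : p - q + (q - p) < 2 ^ M := hB.lt_of_le (le_trans (b := W ^ 3) (by omega)
      (Nat.pow_le_pow_right (by have := hB.sixteen_le; omega) (by omega)))
    refine .seq (.set (by simp) (.seq (.set ?_ (.set ?_ ⟨?_, ?_⟩))))
    · simpa [r19, r20] using hpq
    · simpa [hs.reg_seven, hs.reg_four] using hB.mul_lt
        (le_sq_of_le (factorial_le hB ‹n ≤ L›)) (le_sq_of_le hBW)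
    · simp [hs.reg_seven, hs.reg_four, ← hBdef]
    · simp only [Expr.eval_div, Expr.eval_add, Expr.eval_mul, Expr.eval_sub, Expr.eval_var,
        State.setReg_reg]
      simp only [r19, r20, Nat.reduceEqDiff, if_true, if_false, OfNat.ofNat_ne_zero,
        OfNat.zero_ne_ofNat]
      rcases le_or_gt q p with h | h
      · simp [Nat.sub_eq_zero_of_le h, Nat.cast_sub h]
      · rw [Nat.div_self (by omega)]
        simp [Nat.sub_eq_zero_of_le h.le, Nat.cast_sub h.le]

/-! ### Evaluation of the nodes in rounds. -/

/-- The repeated evaluation of all nodes in the order of their numbers reaches the values `val` if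
the value of every node results from those of the nodes of smaller rank, whatever the contents
of the array are for the others. -/
theorem rounds_ok {M L n m : ℕ} (hm : m ≤ L) {I : ℕ → ℕ} {a b : Fin n → ℕ} {body : Cmd}
    (val rank : Fin m → ℕ) (hrank : ∀ g, rank g < m)
    (hbody : ∀ (g : Fin m) s, Frame I a b s → s.reg 9 = m → s.reg 11 = g →
      (∀ h, s.arr 3 h ≤ totalWeight a b) → body.Ok M L s fun s' =>
        Frame I a b s' ∧ s'.reg 9 = m ∧ (∀ h : ℕ, h ≠ g → s'.arr 3 h = s.arr 3 h) ∧
        s'.arr 3 g ≤ totalWeight a b ∧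
        ((∀ h : Fin m, rank h < rank g → s.arr 3 h = val h) → s'.arr 3 g = val g))
    {s : State} (hs : Frame I a b s) (h9 : s.reg 9 = m) (h3 : s.arr 3 = fun _ => 0) :
    (Cmd.rep 10 (.var 9) (.rep 11 (.var 9) body)).Ok M L s fun s' =>
      Frame I a b s' ∧ ∀ g : Fin m, s'.arr 3 g = val g := by
  refine .rep m (fun r s => Frame I a b s ∧ s.reg 9 = m ∧ (∀ h, s.arr 3 h ≤ totalWeight a b) ∧
    ∀ g : Fin m, rank g < r → s.arr 3 g = val g) (by simp) (by simp [h9]) hm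
    ⟨hs, h9, by simp [h3], by simp⟩ ?_ ?_
  · rintro r hr s ⟨hs, h9, hle, hval⟩
    -- Within round `r`, the nodes of rank `r` become right when their turn comes. Those of smaller
    -- rank stay right, being recomputed from right values.
    refine .rep m (fun j s => Frame I a b s ∧ s.reg 9 = m ∧ (∀ h, s.arr 3 h ≤ totalWeight a b) ∧
      ∀ g : Fin m, rank g < r ∨ (g.1 < j ∧ rank g ≤ r) → s.arr 3 g = val g)
      (by simp) (by simp [h9]) hm ⟨hs.setReg _ (by decide), by simp [h9], by simpa using hle, ?_⟩
      ?_ ?_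
    · rintro g (hg | ⟨hg, -⟩)
      · simpa using hval g hg
      · simp at hg
    · rintro j hj s ⟨hs, h9, hle, hval⟩
      refine (hbody ⟨j, hj⟩ _ (hs.setReg _ (by decide)) (by simp [h9]) (by simp)
        (by simpa using hle)).mono ?_
      rintro s' ⟨hs', h9', hne, hle', hval'⟩
      simp only [State.setReg_arr] at hne hval'
      refine ⟨hs', h9', fun h => ?_, fun g hg => ?_⟩
      · by_cases h' : h = j
        · subst h'; exact hle'
        · rw [hne h h']; exact hle h
      · by_cases h' : g.1 = j
        · obtain rfl : g = ⟨j, hj⟩ := Fin.ext h'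
          exact hval' fun h hh => hval h (Or.inl (by omega))
        · rw [hne g h']
          exact hval g (by omega)
    · rintro s ⟨hs, h9, hle, hval⟩
      exact ⟨hs, h9, hle, fun g hg => hval g (Or.inr ⟨g.2, by omega⟩)⟩
  · rintro s ⟨hs, -, -, hval⟩
    exact ⟨hs, fun g => hval g (hrank g)⟩

/-- The number of proper ancestors of a node with respect to an acyclic relation. -/
noncomputable def ancestorCount {m : ℕ} (r : Fin m → Fin m → Prop) (g : Fin m) : ℕ :=
  {h | Relation.TransGen r h g}.ncard

theorem ancestorCount_lt {m : ℕ} {r : Fin m → Fin m → Prop}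
    (hr : ∀ g, ¬ Relation.TransGen r g g) (g : Fin m) : ancestorCount r g < m := by
  have : {h | Relation.TransGen r h g} ⊂ Set.univ :=
    Set.ssubset_univ_iff.mpr fun h => hr g (h ▸ Set.mem_univ g : g ∈ {h | Relation.TransGen r h g})
  have := Set.ncard_lt_ncard this Set.finite_univ
  simpa [ancestorCount, Set.ncard_univ] using this

/-- Ancestors of `h` are ancestors of `g`, and `h` is an ancestor of `g` but not of itself. Hence
the count is a rank as `rounds_ok` requires. -/
theorem ancestorCount_lt_of_rel {m : ℕ} {r : Fin m → Fin m → Prop}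
    (hr : ∀ g, ¬ Relation.TransGen r g g) {h g : Fin m} (hg : r h g) :
    ancestorCount r h < ancestorCount r g := by
  refine Set.ncard_lt_ncard ⟨fun k hk => Relation.TransGen.tail hk hg, fun hs => hr h ?_⟩
    (Set.toFinite _)
  exact hs (Relation.TransGen.single hg : h ∈ {h | Relation.TransGen r h g})

/-- All that diagrams and circuits have in common; only the evaluation of a single node is left. It
must respect the bound by the total weight for arbitrary bounded array contents, not only for
correct ones. -/
theorem shapProgram_ok {M L W n m : ℕ} (hB : Bounds M L W) (hn : n ≤ L) (hm : m ≤ L)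
    {cl : (Fin n → Bool) → Bool} {e : Fin n → Bool} {x : Fin n} {out : Fin m}
    {w : List ℕ} (hI : Header e x fun i => w.getD i 0) (hIm : w.getD (n + 2) 0 = m)
    (hIo : w.getD (n + 3) 0 = out) {body : Cmd} (val rank : Fin m → ℕ) (hrank : ∀ g, rank g < m)
    (hval : val out = wmc (agreeWeight e x (2 ^ n) ((2 ^ n) ^ n) true)
      (agreeWeight e x (2 ^ n) ((2 ^ n) ^ n) false) cl)
    (hbody : ∀ (g : Fin m) s, Frame (fun i => w.getD i 0)
      (agreeWeight e x (2 ^ n) ((2 ^ n) ^ n) true) (agreeWeight e x (2 ^ n) ((2 ^ n) ^ n) false) s →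
      s.reg 9 = m → s.reg 11 = g →
      (∀ h, s.arr 3 h ≤ totalWeight (agreeWeight e x (2 ^ n) ((2 ^ n) ^ n) true)
        (agreeWeight e x (2 ^ n) ((2 ^ n) ^ n) false)) → body.Ok M L s fun s' =>
        Frame (fun i => w.getD i 0) (agreeWeight e x (2 ^ n) ((2 ^ n) ^ n) true)
          (agreeWeight e x (2 ^ n) ((2 ^ n) ^ n) false) s' ∧ s'.reg 9 = m ∧
        (∀ h : ℕ, h ≠ g → s'.arr 3 h = s.arr 3 h) ∧
        s'.arr 3 g ≤ totalWeight (agreeWeight e x (2 ^ n) ((2 ^ n) ^ n) true)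
          (agreeWeight e x (2 ^ n) ((2 ^ n) ^ n) false) ∧
        ((∀ h : Fin m, rank h < rank g → s.arr 3 h = val h) → s'.arr 3 g = val g)) :
    (shapProgram body).Ok M L (initialState w) fun s => s.reg 1 ≠ 0 ∧
      shap cl e x = (-1) ^ s.reg 0 * (s.reg 2 : ℚ) / (s.reg 1 : ℚ) := by
  have lit : ∀ k, k ≤ 16 → k < 2 ^ M := fun k hk => hB.small_lt hk
  have hnk : ∀ k, k ≤ 16 → n + k < 2 ^ M := fun k hk =>
    hB.add_lt (le_sq_of_le (hB.le_of_le hn)) (le_sq_of_le (hk.trans hB.sixteen_le))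
  refine .seq ((setup_ok hB hn hI (by simp [initialState]) (by simp [initialState])
    (by simp [initialState]) (by simp [initialState])).mono ?_)
  rintro s ⟨hs, h3⟩
  refine .seq (.set ?_ (.seq ((rounds_ok hm val rank hrank hbody (hs.setReg _ (by decide)) ?_
    (by simpa using h3)).mono ?_)))
  · simp [hs.reg_three, lit, hnk]
  · simp [hs.reg_three, hs.arr_zero, ← hIm]
  rintro s ⟨hs, hv⟩
  refine .seq (.set ?_ ((finish_ok hB hn x.pos (hs.setReg _ (by decide))
    (acceptedCount_lt cl e x false) (acceptedCount_lt cl e x true) ?_).mono ?_))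
  · simp [hs.reg_three, lit, hnk]
  · rw [← wmc_agreeWeight, ← hval, ← hv, ← hIo]
    simp [hs.reg_three, hs.arr_zero]
  · rintro s ⟨h1, h2⟩
    rw [h1, h2, ← shap_eq_counts]
    have h : n.factorial * 2 ^ n ≠ 0 := by positivity
    refine ⟨h, ?_⟩
    push_cast
    rw [mul_div_cancel_right₀]
    exact_mod_cast h

/-! ### Reading the input -/

theorem getD_flatten_of_length {k : ℕ} : ∀ (l : List (List ℕ)), (∀ v ∈ l, v.length = k) →
    ∀ g t : ℕ, t < k → l.flatten.getD (g * k + t) 0 = (l.getD g []).getD t 0 := by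
  intro l
  induction l with
  | nil => simp
  | cons v l ih =>
    intro hl g t ht
    have hv : v.length = k := hl v (by simp)
    cases g with
    | zero =>
      rw [zero_mul, zero_add, List.flatten_cons, List.getD_append _ _ _ _ (by omega)]
      rfl
    | succ g =>
      rw [List.flatten_cons, List.getD_append_right _ _ _ _ (by rw [hv]; nlinarith), hv,
        show (g + 1) * k + t - k = g * k + t by rw [Nat.succ_mul]; omega,
        ih (fun u hu => hl u (by simp [hu])) g t ht]
      simp

theorem getD_flatten_ofFn {m k : ℕ} (f : Fin m → List ℕ) (hf : ∀ g, (f g).length = k) (g : Fin m)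
    {t : ℕ} (ht : t < k) : (List.ofFn f).flatten.getD (g * k + t) 0 = (f g).getD t 0 := by
  rw [getD_flatten_of_length _ (by simpa [List.mem_ofFn] using hf) g t ht]
  congr 1
  rw [List.getD_eq_getElem _ _ (by simp)]
  simp

theorem length_flatten_ofFn {m k : ℕ} (f : Fin m → List ℕ) (hf : ∀ g, (f g).length = k) :
    (List.ofFn f).flatten.length = m * k := by
  rw [List.length_flatten, List.map_ofFn, List.sum_ofFn]
  simp [hf]

/-- An input that consists of a header and of `m` blocks of length `k`. -/
def blockInput {n m : ℕ} (e : Fin n → Bool) (x : Fin n) (out : Fin m) (f : Fin m → List ℕ) :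
    List ℕ :=
  [n, (x : ℕ)] ++ (List.ofFn fun y => (e y).toNat) ++ ([m, (out : ℕ)] ++ (List.ofFn f).flatten)

section BlockInput

variable {n m : ℕ} (e : Fin n → Bool) (x : Fin n) (out : Fin m) (f : Fin m → List ℕ)

theorem blockInput_header : Header e x fun i => (blockInput e x out f).getD i 0 := by
  refine ⟨rfl, rfl, fun y => ?_⟩
  simp only [blockInput, List.append_assoc]
  rw [List.getD_append_right _ _ _ _ (by simp), List.getD_append _ _ _ _ (by simp),
    List.getD_eq_getElem _ _ (by simp)]
  simp

theorem blockInput_rest (i : ℕ) : (blockInput e x out f).getD (n + 2 + i) 0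
    = ([m, (out : ℕ)] ++ (List.ofFn f).flatten).getD i 0 := by
  rw [blockInput, List.getD_append_right _ _ _ _ (by simp)]
  congr 1
  simp

theorem blockInput_size : (blockInput e x out f).getD (n + 2) 0 = m :=
  blockInput_rest e x out f 0

theorem blockInput_out : (blockInput e x out f).getD (n + 3) 0 = out :=
  blockInput_rest e x out f 1

theorem blockInput_block {k : ℕ} (hf : ∀ g, (f g).length = k) (g : Fin m) {t : ℕ} (ht : t < k) :
    (blockInput e x out f).getD (4 + n + g * k + t) 0 = (f g).getD t 0 := by
  rw [show 4 + n + g * k + t = n + 2 + (2 + (g * k + t)) by omega, blockInput_rest,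
    List.getD_append_right _ _ _ _ (by simp), ← getD_flatten_ofFn f hf g ht]
  congr 1
  simp

theorem le_inputLength_blockInput {k : ℕ} (hk : 0 < k) (hf : ∀ g, (f g).length = k) :
    n + m ≤ inputLength (blockInput e x out f) := by
  refine le_trans ?_ (length_le_inputLength _)
  simp only [blockInput, List.length_append, length_flatten_ofFn f hf, List.length_ofFn,
    List.length_cons, List.length_nil]
  have := Nat.le_mul_of_pos_right m hk
  omega

end BlockInput

/-- The polynomial that bounds the lengths of the numbers. -/
noncomputable def lengthBound : Polynomial ℕ := 20 * .X ^ 3 + 20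

/-- `20 * L ^ 3 + 20` is five times the exponent `4 * L ^ 3 + 4`. -/
theorem bounds_lengthBound (L : ℕ) : Bounds (lengthBound.eval L) L (2 ^ (4 * L ^ 3 + 4)) := by
  refine ⟨le_rfl, ?_⟩
  rw [← pow_mul]
  refine Nat.pow_le_pow_right (by omega) ?_
  simp only [lengthBound, Polynomial.eval_add, Polynomial.eval_mul, Polynomial.eval_pow,
    Polynomial.eval_X, Polynomial.eval_ofNat]
  omega

theorem le_lengthBound (L : ℕ) : L ≤ lengthBound.eval L := by
  simp only [lengthBound, Polynomial.eval_add, Polynomial.eval_mul, Polynomial.eval_pow,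
    Polynomial.eval_X, Polynomial.eval_ofNat]
  have := le_cube (le_refl L)
  omega

theorem Bounds.add_sixteen_le {M L W : ℕ} (hB : Bounds M L W) : L + 16 ≤ W := by
  have h1 : L ^ 3 * 4 < 2 ^ (L ^ 3 * 4) := Nat.lt_two_pow_self
  have h2 := hB.le
  have h3 := le_cube (le_refl L)
  rw [pow_add, mul_comm 4] at h2
  omega

/-- Addresses in the input are small. -/
theorem Bounds.address_le {M L W n m g k t : ℕ} (hB : Bounds M L W) (hn : n ≤ L) (hg : g < m)
    (hm : m ≤ L) (hk : k ≤ m + 4) (ht : t ≤ m + 4) : 4 + n + g * k + t ≤ W ^ 2 := by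
  have h1 : g * k ≤ L * (L + 4) := Nat.mul_le_mul (by omega) (by omega)
  have h2 : (L + 16) ^ 2 ≤ W ^ 2 := Nat.pow_le_pow_left hB.add_sixteen_le 2
  nlinarith

/-! ### Binary decision diagrams -/

open ShapScore.Expr in
/-- Evaluate the node of a binary decision diagram whose number is in register `11`. -/
def bddBody : Cmd :=
  .seq (.set 12 (4 + var 3 + var 11 * 4)) <|
  -- The candidates for a leaf and for a branch are both computed, and the kind of the node, the
  -- first number of its block, selects one. The other candidate is meaningless but harmless.
  .seq (.put 4 0 (get 0 (var 12 + 1) * var 8)) <|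
  .seq (.put 4 1 ((get 3 (get 0 (var 12 + 2)) * get 2 (get 0 (var 12 + 1))
    + get 3 (get 0 (var 12 + 3)) * get 1 (get 0 (var 12 + 1)))
      / (get 1 (get 0 (var 12 + 1)) + get 2 (get 0 (var 12 + 1))))) <|
  .put 3 (var 11) (get 4 (get 0 (var 12)))

namespace BDD

variable {n : ℕ}

theorem dependsOn_value (D : BDD n) (u : Fin D.size) : DependsOn (fun e => D.value e u)
    {y | ∃ v, Relation.ReflTransGen D.Edge u v ∧ (D.node v).HasLabel y} := by
  refine D.wf.induction (C := fun u => DependsOn (fun e => D.value e u)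
    {y | ∃ v, Relation.ReflTransGen D.Edge u v ∧ (D.node v).HasLabel y}) u fun u ih e e' h => ?_
  rcases hu : D.node u with b | ⟨x, lo, hi⟩
  · simp only [D.value_leaf _ u b hu]
  · have hx : e x = e' x := h x ⟨u, .refl, lo, hi, hu⟩
    simp only [D.value_branch _ u x lo hi hu, hx]
    have he : D.Edge u (if e' x = true then hi else lo) := ⟨e' x, x, lo, hi, hu, rfl⟩
    exact ih _ he fun y ⟨v, hv, hy⟩ => h y ⟨v, .head he hv, hy⟩

/-- The point where freeness enters: below a node labelled `x`, the variable `x` is not read again.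
-/
theorem IsFree.dependsOn {D : BDD n} (hD : D.IsFree) {u v : Fin D.size} {x : Fin n}
    (hu : (D.node u).HasLabel x) (huv : D.Edge u v) :
    DependsOn (fun e => D.value e v) {x}ᶜ := by
  refine (D.dependsOn_value v).mono ?_
  rintro y ⟨w, hw, hy⟩ rfl
  exact hD u w y (.head' huv hw) hu hy

theorem IsOrdered.isFree {D : BDD n} (hD : D.IsOrdered) : D.IsFree := by
  obtain ⟨rank, h⟩ := hD
  have key : ∀ u v, Relation.TransGen D.Edge u v → ∀ x y, (D.node u).HasLabel x →
      (D.node v).HasLabel y → rank x < rank y := by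
    intro u v huv
    induction huv with
    | single huv => exact fun x y => h _ _ x y huv
    | tail _ hvw ih =>
      intro x y hx hy
      -- An inner node of the path has an outgoing edge, hence a label `z` through which the
      -- inequalities compose.
      obtain ⟨b, z, lo, hi, hz, hb⟩ := hvw
      exact (ih x z hx ⟨lo, hi, hz⟩).trans
        (h _ _ z y ⟨b, z, lo, hi, hz, hb⟩ ⟨lo, hi, hz⟩ hy)
  exact fun u v x huv hx hy => lt_irrefl _ (key u v huv x x hx hy)

/-- The value of a node depends on the targets of its edges, so the rank is taken with respect to
the reversed edges. -/
theorem acyclic_swap (D : BDD n) (u : Fin D.size) :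
    ¬ Relation.TransGen (fun v w => D.Edge w v) u u := fun h =>
  D.acyclic u (Relation.transGen_swap.mp h)

theorem body_ok {M L W : ℕ} (hB : Bounds M L W) {D : BDD n} (hD : D.IsFree) (hn : n ≤ L)
    (hm : D.size ≤ L) {I : ℕ → ℕ} {a b : Fin n → ℕ}
    (hI : ∀ u : Fin D.size, ∀ t < 4, I (4 + n + u * 4 + t) = (D.node u).encode.getD t 0)
    (hpos : ∀ y, 0 < a y + b y) (hab : ∀ y, a y + b y ≤ W) (hT : totalWeight a b ≤ W)
    (u : Fin D.size) (s : State) (hs : Frame I a b s) (h9 : s.reg 9 = D.size) (h11 : s.reg 11 = u)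
    (h3 : ∀ h, s.arr 3 h ≤ totalWeight a b) :
    bddBody.Ok M L s fun s' => Frame I a b s' ∧ s'.reg 9 = D.size ∧
      (∀ h : ℕ, h ≠ u → s'.arr 3 h = s.arr 3 h) ∧ s'.arr 3 u ≤ totalWeight a b ∧
      ((∀ v : Fin D.size, ancestorCount (fun v w => D.Edge w v) v
          < ancestorCount (fun v w => D.Edge w v) u → s.arr 3 v = wmc a b fun e => D.value e v) →
        s'.arr 3 u = wmc a b fun e => D.value e u) := by
  have hTpos : 0 < totalWeight a b := Finset.prod_pos fun y _ => hpos y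
  have lit : ∀ k, k ≤ 16 → k < 2 ^ M := fun k hk => hB.small_lt hk
  have hadr : ∀ t ≤ 3, 4 + n + (u : ℕ) * 4 + t < 2 ^ M := fun t ht =>
    hB.lt (hB.address_le hn u.2 hm (by omega) (by omega))
  have hu4 : (u : ℕ) * 4 < 2 ^ M := by have := hadr 0 (by omega); omega
  have h4n : 4 + n < 2 ^ M := by have := hadr 0 (by omega); omega
  have hI0 := hI u 0 (by omega)
  have hI1 := hI u 1 (by omega)
  have hI2 := hI u 2 (by omega)
  have hI3 := hI u 3 (by omega)
  -- All indices are needed: for a leaf the label is a truth value and may exceed the range of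
  -- features, where the arrays contain `0`.
  have hb0 : ∀ i, toArray a i ≤ W ∧ toArray b i ≤ W ∧ toArray a i + toArray b i ≤ W := by
    intro i
    by_cases hi : i < n
    · have := hab ⟨i, hi⟩
      rw [toArray_of_lt _ hi, toArray_of_lt _ hi]
      omega
    · simp [toArray, hi]
  have hlbl : I (4 + n + u * 4 + 1) ≤ W := by
    rw [hI1]
    rcases D.node u with c | ⟨x, lo, hi⟩
    · have := hB.sixteen_le
      cases c <;> simp [BDDNode.encode]
      omega
    · have := hB.le_of_le hn
      simp [BDDNode.encode]
      omega
  have hmul : ∀ (i : ℕ) (c : ℕ), c ≤ W → s.arr 3 i * c ≤ W ^ 2 := fun i c hc =>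
    mul_le_sq ((h3 i).trans hT) hc
  refine .seq (.set ?_ (.seq (.put (lit 0 (by omega)) ?_ (.seq (.put (lit 1 (by omega)) ?_
    (.put ?_ ?_ ?_))))))
  · simpa [hs.reg_three, h11, lit, hu4, h4n] using hadr 0 (by omega)
  · have := hB.lt (mul_le_sq hlbl hT)
    simp [hs.reg_three, h11, lit, hadr, hs.arr_zero, hs.reg_eight, this]
  · have h1 := hmul (I (4 + n + u * 4 + 2)) _ (hb0 (I (4 + n + u * 4 + 1))).2.1
    have h2 := hmul (I (4 + n + u * 4 + 3)) _ (hb0 (I (4 + n + u * 4 + 1))).1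
    have h5 := hB.lt (le_sq_of_le (hb0 (I (4 + n + u * 4 + 1))).2.2)
    simp [hs.reg_three, h11, lit, hadr, hs.arr_zero, hs.arr_one, hs.arr_two, hB.lt h1, hB.lt h2,
      hB.add_lt h1 h2, h5]
  · simp
  · simp
  · refine ⟨(((hs.setReg _ (by decide)).setArr _ _ (by omega)).setArr _ _ (by omega)).setArr _ _
      (by omega), by simp [h9], fun h hh => by simp [h11, hh], ?_⟩
    rw [add_zero] at hI0
    rcases hu : D.node u with c | ⟨x, lo, hi⟩
    · rw [hu] at hI0 hI1
      simp only [BDDNode.encode, List.getD_cons_zero, List.getD_cons_succ] at hI0 hI1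
      have hv : ∀ e, D.value e u = c := fun e => D.value_leaf e u c hu
      simp [hs.reg_three, h11, hs.arr_zero, hI0, hI1, hs.reg_eight, hv]
      cases c <;> simp [wmc_true, wmc_false]
    · rw [hu] at hI0 hI1 hI2 hI3
      simp only [BDDNode.encode, List.getD_cons_zero, List.getD_cons_succ] at hI0 hI1 hI2 hI3
      have elo : D.Edge u lo := ⟨false, x, lo, hi, hu, rfl⟩
      have ehi : D.Edge u hi := ⟨true, x, lo, hi, hu, rfl⟩
      simp [hs.reg_three, h11, hs.arr_zero, hI0, hI1, hI2, hI3, hs.arr_one, hs.arr_two]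
      -- A weighted mean of two numbers up to the total weight stays below it, whether or not they
      -- are already right.
      refine ⟨Nat.div_le_of_le_mul ?_, fun hval => ?_⟩
      · have h1 := Nat.mul_le_mul_right (b x) (h3 lo)
        have h2 := Nat.mul_le_mul_right (a x) (h3 hi)
        linarith
      · rw [hval lo (ancestorCount_lt_of_rel D.acyclic_swap elo),
          hval hi (ancestorCount_lt_of_rel D.acyclic_swap ehi)]
        refine Nat.div_eq_of_eq_mul_left (hpos x) ?_
        rw [wmc_branch a b (h := fun e => D.value e u) hTpos
          (hD.dependsOn ⟨lo, hi, hu⟩ elo) (hD.dependsOn ⟨lo, hi, hu⟩ ehi)]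
        intro e
        rw [D.value_branch e u x lo hi hu]
        split <;> rfl

end BDD

theorem agreeWeight_bounds {M L W n : ℕ} (hB : Bounds M L W) (hn : n ≤ L) (e : Fin n → Bool)
    (x : Fin n) :
    (∀ y, 0 < agreeWeight e x (2 ^ n) ((2 ^ n) ^ n) true y
      + agreeWeight e x (2 ^ n) ((2 ^ n) ^ n) false y) ∧
    (∀ y, agreeWeight e x (2 ^ n) ((2 ^ n) ^ n) true y
      + agreeWeight e x (2 ^ n) ((2 ^ n) ^ n) false y ≤ W) ∧
    totalWeight (agreeWeight e x (2 ^ n) ((2 ^ n) ^ n) true)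
      (agreeWeight e x (2 ^ n) ((2 ^ n) ^ n) false) ≤ W := by
  refine ⟨fun y => by rw [agreeWeight_add]; omega, fun y => ?_,
    prod_agreeWeight_le hB hn e x Finset.univ⟩
  have := prod_agreeWeight_le hB hn e x {y}
  rwa [Finset.prod_singleton] at this

theorem shapPolyTimeBDD_isFree : ShapPolyTimeBDD fun D => D.IsFree := by
  refine polyTimeComputable_of_cmd (shapProgram bddBody) lengthBound le_lengthBound ?_
  rintro ⟨n, D, e, x⟩ hD
  have hlen : ∀ u, (D.node u).encode.length = 4 := fun u => by
    cases D.node u <;> rfl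
  have hL := le_inputLength_blockInput e x D.root (fun u => (D.node u).encode) (by omega) hlen
  have hB := bounds_lengthBound (inputLength (blockInput e x D.root fun u => (D.node u).encode))
  have hn := le_of_add_le_left hL
  have hm := le_of_add_le_right hL
  obtain ⟨hpos, hab, hT⟩ := agreeWeight_bounds hB hn e x
  exact shapProgram_ok hB hn hm (blockInput_header e x D.root _)
    (blockInput_size e x D.root _) (blockInput_out e x D.root _) (cl := D.classifier)
    (fun u => wmc _ _ fun e => D.value e u) _ (ancestorCount_lt D.acyclic_swap) rfl
    fun u s hs h9 h11 h3 => BDD.body_ok hB hD hn hm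
      (fun v t ht => blockInput_block e x D.root _ hlen v ht) hpos hab hT u s hs h9 h11 h3

/-! ### Deterministic and decomposable circuits -/

open ShapScore.Expr in
/-- Evaluate the gate of a circuit whose number is in register `11`: the candidates for the five
kinds of gates are put into the array `4`. -/
def circuitBody : Cmd :=
  .seq (.set 12 (4 + var 3 + var 11 * (2 + var 9))) <|
  .seq (.set 13 (var 8)) <|
  .seq (.set 14 0) <|
  .seq (.rep 15 (var 9) (
    -- The factor is the value of gate number `15` if it is an input, and otherwise `T`, which the
    -- division by `T` cancels.
    .seq (.set 13 (var 13 * (get 0 (var 12 + (2 + var 15)) * get 3 (var 15)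
      + (1 - get 0 (var 12 + (2 + var 15))) * var 8) / var 8)) <|
    .set 14 (var 14 + get 0 (var 12 + (2 + var 15)) * get 3 (var 15)))) <|
  -- `S - (S - T)` is the minimum of `S` and `T`. It limits sums of premature values and leaves
  -- correct ones unchanged.
  .seq (.set 14 (var 14 - (var 14 - var 8))) <|
  .seq (.put 4 0 (get 0 (var 12 + 1) * var 8)) <|
  .seq (.put 4 1 (var 8 * get 1 (get 0 (var 12 + 1))
    / (get 1 (get 0 (var 12 + 1)) + get 2 (get 0 (var 12 + 1))))) <|
  -- For a negation the sum over the inputs has a single term, the value of its input.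
  .seq (.put 4 2 (var 8 - var 14)) <|
  .seq (.put 4 3 (var 13)) <|
  .seq (.put 4 4 (var 14)) <|
  .put 3 (var 11) (get 4 (get 0 (var 12)))

/-- The product of the first `j` numbers `p h`, each divided by `T`, and of `T`. -/
def scaledProd (T : ℕ) (p : ℕ → ℕ) : ℕ → ℕ
  | 0 => T
  | j + 1 => scaledProd T p j * p j / T

theorem scaledProd_le {T : ℕ} {p : ℕ → ℕ} {j : ℕ} (hp : ∀ h < j, p h ≤ T) :
    scaledProd T p j ≤ T := by
  induction j with
  | zero => exact le_rfl
  | succ j ih =>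
    exact Nat.div_le_of_le_mul (Nat.mul_le_mul (ih fun h hh => hp h (by omega)) (hp j (by omega)))

namespace Circuit

variable {n : ℕ}

theorem dependsOn_value (C : Circuit n) (g : Fin C.size) :
    DependsOn (fun e => C.value e g) (C.vars g) := by
  refine C.wf.induction (C := fun g => DependsOn (fun e => C.value e g) (C.vars g)) g
    fun g ih e e' h => ?_
  have hin : ∀ g₁ ∈ (C.gate g).inputs, C.value e g₁ = C.value e' g₁ := fun g₁ hg₁ =>
    ih g₁ hg₁ fun y ⟨g₂, h₂, hy⟩ => h y ⟨g₂, .tail h₂ hg₁, hy⟩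
  rcases hg : C.gate g with b | x | g₁ | t | t
  · simp only [C.value_const _ g b hg]
  · simpa only [C.value_var _ g x hg] using h x ⟨g, .refl, hg⟩
  · simp only [C.value_not _ g g₁ hg, hin g₁ (by simp [hg, Gate.inputs])]
  · simp only [C.value_and _ g t hg]
    refine decide_eq_decide.mpr (forall₂_congr fun g₁ hg₁ => ?_)
    rw [hin g₁ (by simpa [hg, Gate.inputs] using hg₁)]
  · simp only [C.value_or _ g t hg]
    refine decide_eq_decide.mpr (exists_congr fun g₁ => and_congr_right fun hg₁ => ?_)
    rw [hin g₁ (by simpa [hg, Gate.inputs] using hg₁)]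

section Gates

variable (C : Circuit n) {a b : Fin n → ℕ} {t : Finset (Fin C.size)}

/-- Each step adds one input to the conjunction of the earlier ones. By decomposability these do not
depend on the variables of the new input, so `wmc_and` applies and the division by the total weight
is exact. -/
theorem scaledProd_eq_wmc (hT : 0 < totalWeight a b) {p : ℕ → ℕ}
    (hd : ∀ g₁ ∈ t, ∀ g₂ ∈ t, g₁ ≠ g₂ → C.vars g₁ ∩ C.vars g₂ = ∅)
    (hin : ∀ h ∈ t, p h = wmc a b fun e => C.value e h)
    (hout : ∀ h : Fin C.size, h ∉ t → p h = totalWeight a b) :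
    ∀ j ≤ C.size, scaledProd (totalWeight a b) p j
      = wmc a b fun e => decide (∀ h ∈ t, h.1 < j → C.value e h = true) := by
  intro j
  induction j with
  | zero => intro _; simp [scaledProd, wmc_true]
  | succ j ih =>
    intro hj
    rw [scaledProd, ih (by omega)]
    set k : Fin C.size := ⟨j, hj⟩ with hk
    have split : ∀ h : Fin C.size, h.1 < j + 1 ↔ h.1 < j ∨ h = k := fun h => by
      rw [Fin.ext_iff]; simp only [hk]; omega
    by_cases hmem : k ∈ t
    · refine Nat.div_eq_of_eq_mul_left hT ?_
      rw [show p j = _ from hin k hmem]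
      refine (wmc_and a b (S := (C.vars k)ᶜ) ?_ ?_ fun e => ?_).symm
      · intro e e' h
        refine decide_eq_decide.mpr (forall₂_congr fun g hg => forall_congr' fun hgj => ?_)
        have hne : g ≠ k := fun h => by rw [h] at hgj; simp [hk] at hgj
        have hval : C.value e g = C.value e' g := C.dependsOn_value g fun y hy => h y fun hy' => by
          have : y ∈ C.vars g ∩ C.vars k := ⟨hy, hy'⟩
          rw [hd g hg k hmem hne] at this
          exact this
        rw [hval]
      · rw [compl_compl]; exact C.dependsOn_value k
      · rw [Bool.eq_iff_iff]
        simp only [decide_eq_true_eq, Bool.and_eq_true, split]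
        constructor
        · exact fun h => ⟨fun g hg hgj => h g hg (.inl hgj), h k hmem (.inr rfl)⟩
        · rintro ⟨h1, h2⟩ g hg (hgj | rfl)
          · exact h1 g hg hgj
          · exact h2
    · rw [show p j = _ from hout k hmem, Nat.mul_div_cancel _ hT]
      congr 1
      funext e
      refine decide_eq_decide.mpr (forall₂_congr fun g hg => ?_)
      have hne : g ≠ k := fun h => hmem (h ▸ hg)
      simp [split, hne]

/-- By determinism, each further input is disjoint from the disjunction of the earlier ones. -/
theorem sum_eq_wmc {p : ℕ → ℕ}
    (hd : ∀ g₁ ∈ t, ∀ g₂ ∈ t, g₁ ≠ g₂ → ¬ ∃ e, C.value e g₁ = true ∧ C.value e g₂ = true)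
    (hin : ∀ h ∈ t, p h = wmc a b fun e => C.value e h)
    (hout : ∀ h : Fin C.size, h ∉ t → p h = 0) :
    ∀ j ≤ C.size, ∑ h ∈ Finset.range j, p h
      = wmc a b fun e => decide (∃ h ∈ t, h.1 < j ∧ C.value e h = true) := by
  intro j
  induction j with
  | zero => intro _; simp [wmc_false]
  | succ j ih =>
    intro hj
    rw [Finset.sum_range_succ, ih (by omega)]
    set k : Fin C.size := ⟨j, hj⟩ with hk
    have split : ∀ h : Fin C.size, h.1 < j + 1 ↔ h.1 < j ∨ h = k := fun h => by
      rw [Fin.ext_iff]; simp only [hk]; omega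
    by_cases hmem : k ∈ t
    · rw [show p j = _ from hin k hmem]
      refine (wmc_or a b (fun e => ?_) fun e => ?_).symm
      · rw [Bool.eq_iff_iff]
        simp only [decide_eq_true_eq, Bool.or_eq_true, split]
        constructor
        · rintro ⟨g, hg, hgj | rfl, hv⟩
          · exact .inl ⟨g, hg, hgj, hv⟩
          · exact .inr hv
        · rintro (⟨g, hg, hgj, hv⟩ | hv)
          · exact ⟨g, hg, .inl hgj, hv⟩
          · exact ⟨k, hmem, .inr rfl, hv⟩
      · simp only [decide_eq_true_eq]
        rintro ⟨⟨g, hg, hgj, hv⟩, hv'⟩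
        have hne : g ≠ k := fun h => by rw [h] at hgj; simp [hk] at hgj
        exact hd g hg k hmem hne ⟨e, hv, hv'⟩
    · rw [show p j = _ from hout k hmem, add_zero]
      congr 1
      funext e
      refine decide_eq_decide.mpr (exists_congr fun g => and_congr_right fun hg => ?_)
      have hne : g ≠ k := fun h => hmem (h ▸ hg)
      simp [split, hne]

end Gates

theorem encode_length {m : ℕ} (G : Gate n m) : G.encode.length = m + 2 := by
  cases G <;> simp [Gate.encode, Gate.encodeKind]

theorem encode_input {m : ℕ} (G : Gate n m) (h : Fin m) :
    G.encode.getD (2 + h) 0 = if h ∈ G.inputs then 1 else 0 := by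
  rw [Gate.encode, List.getD_append_right _ _ _ _ (by cases G <;> simp [Gate.encodeKind]),
    show 2 + (h : ℕ) - G.encodeKind.length = h by cases G <;> simp [Gate.encodeKind],
    List.getD_eq_getElem _ _ (by simp)]
  simp

theorem body_ok {M L W : ℕ} (hB : Bounds M L W) {C : Circuit n} (hdet : C.IsDeterministic)
    (hdec : C.IsDecomposable) (hn : n ≤ L)
    (hm : C.size ≤ L) {I : ℕ → ℕ} {a b : Fin n → ℕ}
    (hI : ∀ g : Fin C.size, ∀ t < C.size + 2,
      I (4 + n + g * (C.size + 2) + t) = (C.gate g).encode.getD t 0)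
    (hpos : ∀ y, 0 < a y + b y) (hab : ∀ y, a y + b y ≤ W) (hT : totalWeight a b ≤ W)
    (g : Fin C.size) (s : State) (hs : Frame I a b s) (h9 : s.reg 9 = C.size) (h11 : s.reg 11 = g)
    (h3 : ∀ h, s.arr 3 h ≤ totalWeight a b) :
    circuitBody.Ok M L s fun s' => Frame I a b s' ∧ s'.reg 9 = C.size ∧
      (∀ h : ℕ, h ≠ g → s'.arr 3 h = s.arr 3 h) ∧ s'.arr 3 g ≤ totalWeight a b ∧
      ((∀ h : Fin C.size, ancestorCount C.Edge h < ancestorCount C.Edge g →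
          s.arr 3 h = wmc a b fun e => C.value e h) →
        s'.arr 3 g = wmc a b fun e => C.value e g) := by
  have hTpos : 0 < totalWeight a b := Finset.prod_pos fun y _ => hpos y
  have lit : ∀ k, k ≤ 16 → k < 2 ^ M := fun k hk => hB.small_lt hk
  have hadr : ∀ t ≤ C.size + 4, 4 + n + (g : ℕ) * (C.size + 2) + t < 2 ^ M := fun t ht =>
    hB.lt (hB.address_le hn g.2 hm (by omega) ht)
  have hbase : 4 + n + (g : ℕ) * (C.size + 2) < 2 ^ M := hadr 0 (by omega)
  have hg2 : (g : ℕ) * (C.size + 2) < 2 ^ M := by omega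
  have h4n : 4 + n < 2 ^ M := by omega
  have hm2 : C.size + 2 < 2 ^ M := by have := hadr (C.size + 2) (by omega); omega
  have hI0 := hI g 0 (by omega)
  have hI1 := hI g 1 (by omega)
  rw [add_zero] at hI0
  let bit : ℕ → ℕ := fun h => I (4 + n + g * (C.size + 2) + (2 + h))
  have hbit : ∀ h : Fin C.size, bit h = if h ∈ (C.gate g).inputs then 1 else 0 := fun h =>
    (hI g (2 + h) (by omega)).trans (encode_input _ h)
  have hbit_le : ∀ h < C.size, bit h ≤ 1 := fun h hh => by
    rw [hbit ⟨h, hh⟩]; split <;> simp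
  -- `p` and `q` are the terms of the sum for disjunctions and the factors of the product for
  -- conjunctions.
  let p : ℕ → ℕ := fun h => bit h * s.arr 3 h
  let q : ℕ → ℕ := fun h => bit h * s.arr 3 h + (1 - bit h) * totalWeight a b
  have hp : ∀ h < C.size, p h ≤ totalWeight a b := fun h hh =>
    (Nat.mul_le_mul (hbit_le h hh) (h3 h)).trans (by rw [one_mul])
  have hq : ∀ h < C.size, q h ≤ totalWeight a b := fun h hh => by
    have h1 := hbit_le h hh
    have h2 := h3 h
    rcases (show bit h = 0 ∨ bit h = 1 by omega) with h0 | h0 <;> simp [q, h0, h2]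
  have hsum : ∀ j ≤ C.size, ∑ h ∈ Finset.range j, p h ≤ W ^ 2 := fun j hj => by
    refine (Finset.sum_le_card_nsmul _ _ W fun h hh => (hp h ?_).trans hT).trans ?_
    · have := Finset.mem_range.mp hh; omega
    · rw [Finset.card_range, smul_eq_mul]
      exact mul_le_sq (hB.le_of_le (hj.trans hm)) le_rfl
  have hprod : ∀ j ≤ C.size, scaledProd (totalWeight a b) q j ≤ totalWeight a b := fun j hj =>
    scaledProd_le fun h hh => hq h (by omega)
  have hb0 : ∀ i, toArray a i ≤ W ∧ toArray a i + toArray b i ≤ W := by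
    intro i
    by_cases hi : i < n
    · have := hab ⟨i, hi⟩
      rw [toArray_of_lt _ hi, toArray_of_lt _ hi]
      omega
    · simp [toArray, hi]
  have hlbl : I (4 + n + g * (C.size + 2) + 1) ≤ W := by
    rw [hI1]
    have h16 := hB.sixteen_le
    have h2 := hB.le_of_le hn
    rcases C.gate g with c | x | g₁ | t | t <;> simp [Gate.encode, Gate.encodeKind]
    · cases c <;> simp; omega
    · omega
  refine .seq (.set ?_ (.seq (.set ?_ (.seq (.set (lit 0 (by omega)) (.seq (.rep C.size (fun j s' =>
    Frame I a b s' ∧ s'.reg 9 = C.size ∧ s'.reg 11 = g ∧ s'.reg 12 = 4 + n + g * (C.size + 2) ∧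
    s'.arr 3 = s.arr 3 ∧ s'.reg 13 = scaledProd (totalWeight a b) q j ∧
    s'.reg 14 = ∑ h ∈ Finset.range j, p h) ?_ ?_ hm ?_ ?_ ?_)))))))
  · simp [hs.reg_three, h11, h9, lit, hg2, h4n, hbase, hm2, add_comm 2 C.size]
  · simp
  · simp
  · simp [h9]
  · exact ⟨((hs.setReg _ (by decide)).setReg _ (by decide)).setReg _ (by decide), by simp [h9],
      by simp [h11], by simp [hs.reg_three, h11, h9, add_comm 2 C.size], by simp,
      by simp [hs.reg_eight, scaledProd], by simp⟩
  · rintro j hj s' ⟨hs', h9', h11', h12', h3', h13', h14'⟩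
    have hj2 : 2 + j < 2 ^ M := by have := hadr (2 + j) (by omega); omega
    have hadr' := hadr (2 + j) (by omega)
    have hbj : I (4 + n + g * (C.size + 2) + (2 + j)) = bit j := rfl
    have hpj : bit j * s.arr 3 j = p j := rfl
    have hqj : p j + (1 - bit j) * totalWeight a b = q j := rfl
    have hpW : p j < 2 ^ M := hB.lt (le_sq_of_le ((hp j hj).trans hT))
    have hqW : q j < 2 ^ M := hB.lt (le_sq_of_le ((hq j hj).trans hT))
    have hrW : (1 - bit j) * totalWeight a b < 2 ^ M :=
      lt_of_le_of_lt (Nat.le_add_left _ _) hqW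
    have hmW := hB.lt (mul_le_sq ((hprod j hj.le).trans hT) ((hq j hj).trans hT))
    have hsW := hsum (j + 1) hj
    rw [Finset.sum_range_succ] at hsW
    refine .seq (.set ?_ (.set ?_ ?_))
    · simp [h12', lit, hj2, hadr', hs'.arr_zero, h3', hbj, hpj, hpW, hs'.reg_eight, hrW, hqj, hqW,
        h13', hmW]
    · simp [h12', lit, hj2, hadr', hs'.arr_zero, h3', hbj, hpj, hpW, h14', hB.lt hsW]
    · refine ⟨((hs'.setReg _ (by decide)).setReg _ (by decide)).setReg _ (by decide), by simp [h9'],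
        by simp [h11'], by simp [h12'], by simp [h3'], ?_, ?_⟩
      · simp [h12', hs'.arr_zero, h3', hbj, hpj, hs'.reg_eight, hqj, h13', scaledProd]
      · simp [h12', hs'.arr_zero, h3', hbj, hpj, h14', Finset.sum_range_succ]
  rintro s' ⟨hs', h9', h11', h12', h3', h13', h14'⟩
  have hadr1 := hadr 1 (by omega)
  refine .seq (.set (by simp) (.seq (.put (lit 0 (by omega)) ?_ (.seq (.put (lit 1 (by omega)) ?_
    (.seq (.put (lit 2 (by omega)) (by simp) (.seq (.put (lit 3 (by omega)) (by simp)
    (.seq (.put (lit 4 (by omega)) (by simp) (.put (by simp) (by simp) ?_))))))))))))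
  · simp [h12', lit, hadr1, hs'.arr_zero, hs'.reg_eight, hB.lt (mul_le_sq hlbl hT)]
  · have h1 := hb0 (I (4 + n + g * (C.size + 2) + 1))
    simp [h12', lit, hadr1, hs'.arr_zero, hs'.arr_one, hs'.arr_two, hs'.reg_eight,
      hB.lt (mul_le_sq hT h1.1), hB.lt (le_sq_of_le h1.2)]
  refine ⟨((((((hs'.setReg _ (by decide)).setArr _ _ (by omega)).setArr _ _ (by omega)).setArr _ _
    (by omega)).setArr _ _ (by omega)).setArr _ _ (by omega)).setArr _ _ (by omega),
    by simp [h9'], fun h hh => by simp [h11', hh, h3'], ?_⟩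
  have hin : ∀ (t : Finset (Fin C.size)), (C.gate g).inputs = t →
      (∀ h : Fin C.size, ancestorCount C.Edge h < ancestorCount C.Edge g →
        s.arr 3 h = wmc a b fun e => C.value e h) →
      ∀ h ∈ t, bit h = 1 ∧ s.arr 3 h = wmc a b fun e => C.value e h := by
    rintro t rfl hval h hh
    exact ⟨by rw [hbit, if_pos hh], hval h (ancestorCount_lt_of_rel C.acyclic hh)⟩
  have hout : ∀ (t : Finset (Fin C.size)), (C.gate g).inputs = t → ∀ h : Fin C.size, h ∉ t → bit h = 0 := by
    rintro t rfl h hh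
    rw [hbit, if_neg hh]
  have cap_eq : ∀ S : ℕ, S ≤ totalWeight a b → S - (S - totalWeight a b) = S := fun S h => by omega
  rcases hg : C.gate g with c | x | g₁ | t | t <;>
    simp only [hg, Gate.encode, Gate.encodeKind, List.getD_append, List.length_cons,
      List.length_nil, List.getD_cons_zero, List.getD_cons_succ, Nat.reduceAdd, Nat.reduceLT]
      at hI0 hI1
  · simp [h12', h11', hs'.arr_zero, hI0, hI1, hs'.reg_eight]
    have hv : ∀ e, C.value e g = c := fun e => C.value_const e g c hg
    simp only [hv]
    cases c <;> simp [wmc_true, wmc_false]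
  · simp [h12', h11', hs'.arr_zero, hI0, hI1, hs'.reg_eight, hs'.arr_one, hs'.arr_two]
    have hv : ∀ e, C.value e g = e x := fun e => C.value_var e g x hg
    simp only [hv]
    have hw : totalWeight a b * a x / (a x + b x) = wmc a b fun e => e x :=
      Nat.div_eq_of_eq_mul_left (hpos x) (wmc_var a b x).symm
    rw [hw]
    exact ⟨wmc_le _ _ _, fun _ => rfl⟩
  · simp [h12', h11', hs'.arr_zero, hI0, hs'.reg_eight, h14']
    intro hval
    have hp1 : ∑ h ∈ Finset.range C.size, p h = wmc a b fun e => C.value e g₁ := by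
      have h1 := hin {g₁} (by simp [hg, Gate.inputs]) hval g₁ (by simp)
      rw [Finset.sum_eq_single_of_mem (g₁ : ℕ) (by simp)]
      · simp only [p, h1, one_mul]
      · intro h hh hne
        have := hout {g₁} (by simp [hg, Gate.inputs]) ⟨h, Finset.mem_range.mp hh⟩
          (by simpa [Fin.ext_iff] using hne)
        simp only at this
        simp [p, this]
    rw [hp1, cap_eq _ (wmc_le _ _ _)]
    exact (wmc_not a b fun e => C.value_not e g g₁ hg).symm
  · simp [h12', h11', hs'.arr_zero, hI0, h13']
    refine ⟨hprod C.size le_rfl, fun hval => ?_⟩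
    have hin := hin t (by simp [hg, Gate.inputs]) hval
    have hout := hout t (by simp [hg, Gate.inputs])
    rw [C.scaledProd_eq_wmc hTpos (hdec g t hg) (fun h hh => by simp [q, hin h hh])
      (fun h hh => by simp [q, hout h hh]) C.size le_rfl]
    simp only [C.value_and _ g t hg]
    congr 1
    funext e
    exact decide_eq_decide.mpr (forall₂_congr fun h _ => by simp)
  · simp [h12', h11', hs'.arr_zero, hI0, h14', hs'.reg_eight]
    refine ⟨by omega, fun hval => ?_⟩
    have hin := hin t (by simp [hg, Gate.inputs]) hval
    have hout := hout t (by simp [hg, Gate.inputs])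
    have hsum := C.sum_eq_wmc (p := p) (hdet g t hg) (fun h hh => by simp [p, hin h hh])
      (fun h hh => by simp [p, hout h hh]) (a := a) (b := b) C.size le_rfl
    rw [hsum, cap_eq _ (wmc_le _ _ _)]
    simp only [C.value_or _ g t hg]
    congr 1
    funext e
    exact decide_eq_decide.mpr (exists_congr fun h => by simp)

end Circuit

theorem shapPolyTimeCircuit_isdDNNF : ShapPolyTimeCircuit fun C => C.IsdDNNF := by
  refine polyTimeComputable_of_cmd (shapProgram circuitBody) lengthBound le_lengthBound ?_
  rintro ⟨n, C, e, x⟩ ⟨hdet, hdec, -⟩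
  have hlen : ∀ g, (C.gate g).encode.length = C.size + 2 := fun g => Circuit.encode_length _
  have hL := le_inputLength_blockInput e x C.output (fun g => (C.gate g).encode) (by omega) hlen
  have hB := bounds_lengthBound (inputLength (blockInput e x C.output fun g => (C.gate g).encode))
  have hn := le_of_add_le_left hL
  have hm := le_of_add_le_right hL
  obtain ⟨hpos, hab, hT⟩ := agreeWeight_bounds hB hn e x
  exact shapProgram_ok hB hn hm (blockInput_header e x C.output _)
    (blockInput_size e x C.output _) (blockInput_out e x C.output _) (cl := C.classifier)
    (fun g => wmc _ _ fun e => C.value e g) _ (ancestorCount_lt C.acyclic) rfl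
    fun g s hs h9 h11 h3 => Circuit.body_ok hB hdet hdec hn hm
      (fun g' t ht => blockInput_block e x C.output _ hlen g' ht) hpos hab hT g s hs h9 h11 h3

end ShapScore

/-- Decision trees are free by definition and ordered diagrams by `IsOrdered.isFree`, so one program
with one polynomial serves all three classes of diagrams. -/
theorem mainTheorem5 :
    ShapScore.ShapPolyTimeBDD (fun D => D.IsDecisionTree) ∧
    ShapScore.ShapPolyTimeBDD (fun D => D.IsOrdered) ∧
    ShapScore.ShapPolyTimeBDD (fun D => D.IsFree) ∧
    ShapScore.ShapPolyTimeCircuit (fun C => C.IsdDNNF) := by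
  obtain ⟨p, q, h⟩ := ShapScore.shapPolyTimeBDD_isFree
  exact ⟨⟨p, q, fun i hi => h i hi.1⟩, ⟨p, q, fun i hi => h i hi.isFree⟩, ⟨p, q, h⟩,
    ShapScore.shapPolyTimeCircuit_isdDNNF⟩
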